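/- Let $E$ be a finite-dimensional Euclidean space (for instance $E=\mathbb R$) and let $\nu$ be a Lévy measure on $E$, that is, a positive Borel measure with $\nu(\{0\})=0$ and $\int \min(1,|z|^2)\,d\nu(z)<\infty$. Let $(L_t)_{t\ge 0}$ be the associated pure-jump Lévy semigroup: $L_tf(x)=\int f(x+y)\,d\mu_t(y)$, where $(\mu_t)_{t\ge0}$ is a weakly continuous convolution semigroup of probability measures on $E$ with $\mu_0=\delta_0$, and where the infinitesimal generator of $(L_t)$ is $$\mathcal I(f)(x)=\int\Big(f(x+z)-f(x)-\frac{\nabla f(x)\cdot z}{1+|z|^2}\Big)\,d\nu(z),$$ i.e. $\lim_{t\to0^+}\big(L_tf(x)-f(x)\big)/t=\mathcal I(f)(x)$ for every $f\in C_c^\infty(E)$ and $x\in E$. (i) For all $0<s\le t$ and $0<q_2\le q_1<1$ such that $q_2-1=\frac{q_2}{q_1}\,\frac ts\,(q_1-1)$, every Borel function $f:E\to[0,\infty]$ satisfies, at every point of $E$, $$\big(L_t(f^{q_1})\big)^{1/q_1}\le \big(L_s\big((L_{t-s}f)^{q_2}\big)\big)^{1/q_2}.$$ (ii) If moreover $C:=\nu(E)<\infty$,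 then for all $0<s\le t$ and $0<q_2\le q_1<1$ such that $q_2-1=\frac ts\,(q_1-1)$, every Borel function $f:E\to[0,\infty]$ satisfies, at every point of $E$, $$\big(L_t(f^{q_1})\big)^{1/q_1}\le \big(L_s\big((L_{t-s}f)^{q_2}\big)\big)^{1/q_2}\,\exp\Big[C\,\frac{s(t-s)(1-q_2)^2}{q_2(sq_2+t-s)}\Big].$$ Both sides are allowed to take the value $+\infty$. -/

import Mathlib

open MeasureTheory Filter Topology Set
open scoped ENNReal ContDiff

/-- `ν` is a Lévy measure: `ν({0}) = 0` and `∫ min(1, |z|²) dν(z) < ∞`. -/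
structure IsLevyMeasure {E : Type*} [NormedAddCommGroup E] [MeasurableSpace E]
    (ν : Measure E) : Prop where
  zero_singleton : ν {0} = 0
  lintegral_lt_top : ∫⁻ z, ENNReal.ofReal (min 1 (‖z‖ ^ 2)) ∂ν < ⊤

/-- The pure-jump Lévy operator
`I(f)(x) = ∫ (f(x+z) - f(x) - ∇f(x)·z h(z)) dν(z)` with `h(z) = 1/(1+|z|²)`.
The integrand is `ν`-integrable for all smooth compactly supported `f` when `ν` is a
Lévy measure. -/
noncomputable def levyOperator {E : Type*} [NormedAddCommGroup E] [NormedSpace ℝ E]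
    [MeasurableSpace E] (ν : Measure E) (f : E → ℝ) (x : E) : ℝ :=
  ∫ z, (f (x + z) - f x - fderiv ℝ f x z * (1 / (1 + ‖z‖ ^ 2))) ∂ν

/-- `(μ t)`, `t ≥ 0`, is the family of one-dimensional laws of a Lévy process started at `0`:
a convolution semigroup of probability measures which is weakly continuous at `t = 0`.
Only the values at `t ≥ 0` are relevant. -/
structure IsConvolutionSemigroup {E : Type*} [NormedAddCommGroup E] [MeasurableSpace E]
    (μ : ℝ → Measure E) : Prop where
  isProbabilityMeasure : ∀ t, 0 ≤ t → IsProbabilityMeasure (μ t)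
  zero : μ 0 = Measure.dirac 0
  add : ∀ s t, 0 ≤ s → 0 ≤ t → μ (s + t) = (μ s).conv (μ t)
  tendsto_zero : ∀ f : E → ℝ, Continuous f → (∃ M : ℝ, ∀ y, |f y| ≤ M) →
    Tendsto (fun t => ∫ y, f y ∂(μ t)) (𝓝[>] 0) (𝓝 (f 0))

/-- The pure-jump Lévy semigroup associated with `ν`, given by the laws `(μ t)`: the Markov
semigroup `L_t f(x) = ∫ f(x+y) dμ_t(y)` has infinitesimal generator `levyOperator ν`
on smooth compactly supported functions. -/
structure IsPureJumpLevySemigroup {E : Type*} [NormedAddCommGroup E] [NormedSpace ℝ E]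
    [MeasurableSpace E] (ν : Measure E) (μ : ℝ → Measure E) : Prop
    extends IsConvolutionSemigroup μ where
  generator : ∀ f : E → ℝ, ContDiff ℝ ∞ f → HasCompactSupport f → ∀ x : E,
    Tendsto (fun t : ℝ => ((∫ y, f (x + y) ∂(μ t)) - f x) / t) (𝓝[>] 0)
      (𝓝 (levyOperator ν f x))

/-- The action `L_t f(x) = ∫ f(x+y) dμ_t(y)` of the semigroup on nonnegative (possibly
unbounded) functions, with values in `[0, ∞]`. -/
noncomputable def levyAct {E : Type*} [NormedAddCommGroup E] [MeasurableSpace E]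
    (μ : ℝ → Measure E) (t : ℝ) (f : E → ℝ≥0∞) (x : E) : ℝ≥0∞ :=
  ∫⁻ y, f (x + y) ∂(μ t)

/-! Let X be the process with laws μ, and put r = s/t, a = q₁, α = a/(1-a), b = q₂/(1-q₂), so that
-b is the conjugate exponent of q₂. The theorem is dual to a reverse Hölder inequality for the
coupling (X_t, X_s): ‖f‖_a ‖h‖_{-b} ≤ K E[f(X_t) h(X_s)] for positive f and h (`ReverseHC`). Taking
h = (L_{t-s} f)^(q₂-1) recovers the bound on ‖f‖_{q₁} (`ConvolutionFamily.integral_rpow_le`).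

Such inequalities tensorise: convolving two couplings multiplies the constants (`ReverseHC.conv`).
Consider the sum of n independent copies of (Y, BY), with Y of law μ_{t/n} and B an independent
Bernoulli(r) variable. Its law is the binomial mixture of the laws of (X_t, X_{it/n}), so
expectations under it are Bernstein polynomials evaluated at r, and they converge to expectations
under the law of (X_t, X_s) (`ConvolutionFamily.tendsto_integral_convPow`). Hence one small cell (Y,
BY) is enough, with a constant k_n such that k_n^n → K.

In a cell, E[h(BY) | Y] = r h(Y) + (1-r) h(0), and reverse Hölder eliminates f. In (i) the relation
reads b = rα, and weighted AM-GM gives k_n = 1 whatever the law of Y. In (ii) it reads 1+b = r(1+α).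
There finiteness of ν gives, once the drift is removed, an atom at 0 of mass at least exp(-Ct/n),
and expanding in the missing mass p = Ct/n gives k_n = exp(p(r/b - 1/α) + O(p²)). The atom is
extracted from the generator by an Euler scheme
(`IsPureJumpLevySemigroup.exp_le_measure_singleton`). -/

/-- A measurable real function with values in a compact subinterval of `(0, ∞)`. -/
def BddPos {α : Type*} [MeasurableSpace α] (f : α → ℝ) : Prop :=
  Measurable f ∧ ∃ c C : ℝ, 0 < c ∧ ∀ x, c ≤ f x ∧ f x ≤ C

/-! ### Functions bounded above and away from zero, stable under real powers of either sign -/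

namespace BddPos

variable {α β : Type*} [MeasurableSpace α] [MeasurableSpace β] {f g : α → ℝ}

lemma pos (hf : BddPos f) (x : α) : 0 < f x := by
  obtain ⟨-, c, C, hc, h⟩ := hf
  exact hc.trans_le (h x).1

lemma comp (hf : BddPos f) {φ : β → α} (hφ : Measurable φ) : BddPos (fun x => f (φ x)) := by
  obtain ⟨hm, c, C, hc, h⟩ := hf
  exact ⟨hm.comp hφ, c, C, hc, fun x => h _⟩

lemma rpow (hf : BddPos f) (a : ℝ) : BddPos (fun x => f x ^ a) := by
  obtain ⟨hm, c, C, hc, h⟩ := hf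
  rcases le_total 0 a with ha | ha
  · refine ⟨hm.pow_const a, c ^ a, C ^ a, Real.rpow_pos_of_pos hc a, fun x => ⟨?_, ?_⟩⟩
    · exact Real.rpow_le_rpow hc.le (h x).1 ha
    · exact Real.rpow_le_rpow (hc.le.trans (h x).1) (h x).2 ha
  · rcases isEmpty_or_nonempty α with he | ⟨⟨x₀⟩⟩
    · exact ⟨hm.pow_const a, 1, 1, one_pos, fun x => he.elim x⟩
    have hC : 0 < C := hc.trans_le ((h x₀).1.trans (h x₀).2)
    refine ⟨hm.pow_const a, C ^ a, c ^ a, Real.rpow_pos_of_pos hC a, fun x => ⟨?_, ?_⟩⟩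
    · exact Real.rpow_le_rpow_of_nonpos (hc.trans_le (h x).1) (h x).2 ha
    · exact Real.rpow_le_rpow_of_nonpos hc (h x).1 ha

lemma mul (hf : BddPos f) (hg : BddPos g) : BddPos (fun x => f x * g x) := by
  obtain ⟨hm, c, C, hc, h⟩ := hf
  obtain ⟨hm', c', C', hc', h'⟩ := hg
  refine ⟨hm.mul hm', c * c', C * C', mul_pos hc hc', fun x => ⟨?_, ?_⟩⟩
  · exact mul_le_mul (h x).1 (h' x).1 hc'.le (hc.le.trans (h x).1)
  · exact mul_le_mul (h x).2 (h' x).2 (hc'.le.trans (h' x).1)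
      ((hc.le.trans (h x).1).trans (h x).2)

lemma integrable (hf : BddPos f) (μ : Measure α) [IsFiniteMeasure μ] : Integrable f μ := by
  obtain ⟨hm, c, C, hc, h⟩ := hf
  refine Integrable.of_bound hm.aestronglyMeasurable C (Eventually.of_forall fun x => ?_)
  rw [Real.norm_of_nonneg (hc.le.trans (h x).1)]
  exact (h x).2

lemma integral_mem {μ : Measure α} [IsProbabilityMeasure μ] {c C : ℝ} (hf : BddPos f)
    (h : ∀ x, c ≤ f x ∧ f x ≤ C) : c ≤ ∫ x, f x ∂μ ∧ ∫ x, f x ∂μ ≤ C := by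
  constructor
  · simpa using integral_mono (μ := μ) (integrable_const c) (hf.integrable μ) fun x => (h x).1
  · simpa using integral_mono (μ := μ) (hf.integrable μ) (integrable_const C) fun x => (h x).2

lemma integral_pos (hf : BddPos f) (μ : Measure α) [IsProbabilityMeasure μ] :
    0 < ∫ x, f x ∂μ := by
  obtain ⟨c, C, hc, h⟩ := hf.2
  exact hc.trans_le (hf.integral_mem h).1

lemma integral_prod_right {F : α × β → ℝ} (hF : BddPos F) (μ : Measure β)
    [IsProbabilityMeasure μ] : BddPos (fun x => ∫ y, F (x, y) ∂μ) := by
  obtain ⟨c, C, hc, h⟩ := hF.2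
  refine ⟨?_, c, C, hc, fun x => ?_⟩
  · exact (hF.1.stronglyMeasurable.integral_prod_right' (ν := μ)).measurable
  · exact (hF.comp (measurable_prodMk_left (x := x))).integral_mem fun y => h _

lemma const {c : ℝ} (hc : 0 < c) : BddPos (fun _ : α => c) :=
  ⟨measurable_const, c, c, hc, fun _ => ⟨le_rfl, le_rfl⟩⟩

lemma add (hf : BddPos f) (hg : BddPos g) : BddPos (fun x => f x + g x) := by
  obtain ⟨hm, c, C, hc, h⟩ := hf
  obtain ⟨hm', c', C', hc', h'⟩ := hg
  exact ⟨hm.add hm', c + c', C + C', add_pos hc hc', fun x =>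
    ⟨add_le_add (h x).1 (h' x).1, add_le_add (h x).2 (h' x).2⟩⟩

end BddPos

/-! ### Reverse Hölder inequalities for couplings and their tensorisation -/

lemma MeasureTheory.Measure.integral_conv_eq {M : Type*} [AddMonoid M] [MeasurableSpace M]
    [MeasurableAdd₂ M] {μ ν : Measure M} [SFinite μ] [SFinite ν] {f : M → ℝ} (hm : Measurable f)
    (hf : Integrable f (μ.conv ν)) :
    ∫ z, f z ∂(μ.conv ν) = ∫ x, ∫ y, f (x + y) ∂ν ∂μ := by
  have hadd : Measurable (fun x : M × M => x.1 + x.2) := measurable_add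
  rw [Measure.conv] at hf ⊢
  rw [integral_map hadd.aemeasurable hm.aestronglyMeasurable]
  exact integral_prod _ (hf.comp_measurable hadd)

instance Prod.instMeasurableAdd₂ {M N : Type*} [Add M] [Add N] [MeasurableSpace M]
    [MeasurableSpace N] [MeasurableAdd₂ M] [MeasurableAdd₂ N] : MeasurableAdd₂ (M × N) where
  measurable_add := by
    change Measurable fun p : (M × N) × (M × N) => (p.1.1 + p.2.1, p.1.2 + p.2.2)
    fun_prop

/-- A reverse Hölder inequality with constant `K` between the two marginals of a coupling. -/
def ReverseHC {E : Type*} [MeasurableSpace E] (κ : Measure (E × E)) (a b K : ℝ) : Prop :=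
  ∀ f h : E → ℝ, BddPos f → BddPos h →
    (∫ p, f p.1 ^ a ∂κ) ^ (1 / a) * (∫ p, h p.2 ^ (-b) ∂κ) ^ (-(1 / b)) ≤
      K * ∫ p, f p.1 * h p.2 ∂κ

lemma ReverseHC.dirac {E : Type*} [MeasurableSpace E] (a b : ℝ) (ha : a ≠ 0) (hb : b ≠ 0) (x : E × E) :
    ReverseHC (Measure.dirac x) a b 1 := by
  intro f h hf hh
  rw [integral_dirac' _ _ ((hf.rpow a).comp measurable_fst).1.stronglyMeasurable,
    integral_dirac' _ _ ((hh.rpow (-b)).comp measurable_snd).1.stronglyMeasurable,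
    integral_dirac' _ _
      ((hf.comp measurable_fst).mul (hh.comp measurable_snd)).1.stronglyMeasurable,
    ← Real.rpow_mul (hf.pos _).le, ← Real.rpow_mul (hh.pos _).le, neg_mul_neg,
    mul_one_div_cancel ha, mul_one_div_cancel hb, Real.rpow_one, Real.rpow_one, one_mul]

namespace ReverseHC

variable {E : Type*} [MeasurableSpace E] [AddCommMonoid E] [MeasurableAdd₂ E]

/-- Condition on the first step x = (x₁, x₂). The inequality for κ₂, applied to the translates of f
and h, bounds the inner integral below by the product of a function of x₁ and a function of x₂.
These are exactly the partial norms to which the inequality for κ₁ applies. -/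
lemma conv {κ₁ κ₂ : Measure (E × E)} [IsProbabilityMeasure κ₁] [IsProbabilityMeasure κ₂]
    {a b K₁ K₂ : ℝ} (ha : a ≠ 0) (hb : b ≠ 0) (hK : 0 ≤ K₁)
    (h₁ : ReverseHC κ₁ a b K₁) (h₂ : ReverseHC κ₂ a b K₂) :
    ReverseHC (κ₁.conv κ₂) a b (K₁ * K₂) := by
  intro f h hf hh
  have key : ∀ {g : E × E → ℝ}, BddPos g →
      ∫ z, g z ∂(κ₁.conv κ₂) = ∫ x, ∫ y, g (x + y) ∂κ₂ ∂κ₁ := fun hg =>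
    Measure.integral_conv_eq hg.1 (hg.integrable _)
  have hF' : BddPos (fun x : E => ∫ y, f (x + y.1) ^ a ∂κ₂) :=
    ((hf.rpow a).comp (φ := fun p : E × (E × E) => p.1 + p.2.1)
      (by fun_prop)).integral_prod_right κ₂
  have hH' : BddPos (fun x : E => ∫ y, h (x + y.2) ^ (-b) ∂κ₂) :=
    ((hh.rpow (-b)).comp (φ := fun p : E × (E × E) => p.1 + p.2.2)
      (by fun_prop)).integral_prod_right κ₂
  have hfh : BddPos (fun p : E × E => f p.1 * h p.2) :=
    (hf.comp measurable_fst).mul (hh.comp measurable_snd)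
  have hfhI : BddPos (fun x : E × E => ∫ y, f (x.1 + y.1) * h (x.2 + y.2) ∂κ₂) :=
    (hfh.comp (φ := fun p : (E × E) × (E × E) => p.1 + p.2)
      (by fun_prop)).integral_prod_right κ₂
  rw [key ((hf.rpow a).comp measurable_fst), key ((hh.rpow (-b)).comp measurable_snd), key hfh]
  simp only [Prod.fst_add, Prod.snd_add]
  have hFa : ∀ x : E × E, ((∫ y, f (x.1 + y.1) ^ a ∂κ₂) ^ (1 / a)) ^ a
      = ∫ y, f (x.1 + y.1) ^ a ∂κ₂ := fun x => by
    rw [← Real.rpow_mul (hF'.pos x.1).le, one_div_mul_cancel ha, Real.rpow_one]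
  have hHb : ∀ x : E × E, ((∫ y, h (x.2 + y.2) ^ (-b) ∂κ₂) ^ (-(1 / b))) ^ (-b)
      = ∫ y, h (x.2 + y.2) ^ (-b) ∂κ₂ := fun x => by
    rw [← Real.rpow_mul (hH'.pos x.2).le, neg_mul_neg, one_div_mul_cancel hb, Real.rpow_one]
  have step₁ := h₁ _ _ (hF'.rpow (1 / a)) (hH'.rpow (-(1 / b)))
  simp only [hFa, hHb] at step₁
  refine step₁.trans ?_
  rw [mul_assoc]
  refine mul_le_mul_of_nonneg_left ?_ hK
  rw [← integral_const_mul]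
  refine integral_mono (BddPos.integrable ?_ κ₁) ((hfhI.integrable κ₁).const_mul K₂) fun x => ?_
  · exact ((hF'.rpow (1 / a)).comp measurable_fst).mul ((hH'.rpow (-(1 / b))).comp measurable_snd)
  · exact h₂ _ _ (hf.comp (φ := fun y => x.1 + y) (by fun_prop))
      (hh.comp (φ := fun y => x.2 + y) (by fun_prop))

end ReverseHC

/-- The `n`-fold convolution power of a measure. -/
noncomputable def convPow {M : Type*} [AddMonoid M] [MeasurableSpace M] (κ : Measure M) :
    ℕ → Measure M
  | 0 => Measure.dirac 0
  | n + 1 => (convPow κ n).conv κ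

instance {M : Type*} [AddMonoid M] [MeasurableSpace M] [MeasurableAdd₂ M] (κ : Measure M)
    [IsProbabilityMeasure κ] (n : ℕ) : IsProbabilityMeasure (convPow κ n) := by
  induction n with
  | zero => rw [convPow]; infer_instance
  | succ n ih => rw [convPow]; infer_instance

lemma ReverseHC.convPow {E : Type*} [MeasurableSpace E] [AddCommMonoid E] [MeasurableAdd₂ E]
    {κ : Measure (E × E)} [IsProbabilityMeasure κ] {a b K : ℝ} (ha : a ≠ 0) (hb : b ≠ 0)
    (hK : 0 ≤ K) (h : ReverseHC κ a b K) (n : ℕ) : ReverseHC (convPow κ n) a b (K ^ n) := by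
  induction n with
  | zero => simpa [_root_.convPow] using ReverseHC.dirac a b ha hb (0 : E × E)
  | succ n ih => exact pow_succ K n ▸ ih.conv ha hb (pow_nonneg hK n) h

/-! ### The one-cell inequality for (Y, BY) -/

/-- Hölder with exponents 1/a and 1/(1-a) for f^a = (fg)^a · g^(-a). The exponent -a/(1-a) is the
conjugate of a. -/
lemma reverse_holder {α : Type*} [MeasurableSpace α] (μ : Measure α) [IsProbabilityMeasure μ]
    {a : ℝ} (ha : 0 < a) (ha1 : a < 1) {f g : α → ℝ} (hf : BddPos f) (hg : BddPos g) :
    (∫ x, f x ^ a ∂μ) ^ (1 / a) * (∫ x, g x ^ (-(a / (1 - a))) ∂μ) ^ (-(1 / (a / (1 - a)))) ≤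
      ∫ x, f x * g x ∂μ := by
  have h1a : 0 < 1 - a := by linarith
  have hfg := hf.mul hg
  have hI := hfg.integral_pos μ
  have hJ := (hg.rpow (-(a / (1 - a)))).integral_pos μ
  have hpq : (1 / a).HolderConjugate (1 / (1 - a)) := by
    rw [Real.holderConjugate_iff]
    refine ⟨by rw [lt_div_iff₀ ha]; linarith, by field_simp; ring⟩
  have memLp : ∀ {k : α → ℝ}, BddPos k → ∀ p, MemLp k p μ := by
    rintro k ⟨hm, c, C, hc, h⟩ p
    refine MemLp.of_bound hm.aestronglyMeasurable C (Eventually.of_forall fun x => ?_)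
    rw [Real.norm_of_nonneg (hc.le.trans (h x).1)]
    exact (h x).2
  have hold := integral_mul_le_Lp_mul_Lq_of_nonneg (μ := μ) hpq
    (f := fun x => (f x * g x) ^ a) (g := fun x => g x ^ (-a))
    (Eventually.of_forall fun x => ((hfg.rpow a).pos x).le)
    (Eventually.of_forall fun x => ((hg.rpow (-a)).pos x).le)
    (memLp (hfg.rpow a) _) (memLp (hg.rpow (-a)) _)
  have e1 : ∀ x, (f x * g x) ^ a * g x ^ (-a) = f x ^ a := fun x => by
    have := hg.pos x
    rw [Real.mul_rpow (hf.pos x).le this.le, mul_assoc, ← Real.rpow_add this, add_neg_cancel,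
      Real.rpow_zero, mul_one]
  have e2 : ∀ x, ((f x * g x) ^ a) ^ (1 / a) = f x * g x := fun x => by
    rw [← Real.rpow_mul (hfg.pos x).le, mul_one_div_cancel ha.ne', Real.rpow_one]
  have e3 : ∀ x, (g x ^ (-a)) ^ (1 / (1 - a)) = g x ^ (-(a / (1 - a))) := fun x => by
    rw [← Real.rpow_mul (hg.pos x).le]; congr 1; ring
  simp only [e1, e2, e3, one_div_one_div] at hold
  set I := ∫ x, f x * g x ∂μ
  set J := ∫ x, g x ^ (-(a / (1 - a))) ∂μ
  have h4 : (∫ x, f x ^ a ∂μ) ^ (1 / a) ≤ (I ^ a * J ^ (1 - a)) ^ (1 / a) :=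
    Real.rpow_le_rpow ((hf.rpow a).integral_pos μ).le hold (by positivity)
  have h5 : (I ^ a * J ^ (1 - a)) ^ (1 / a) = I * J ^ (1 / (a / (1 - a))) := by
    rw [Real.mul_rpow (by positivity) (by positivity), ← Real.rpow_mul hI.le, ← Real.rpow_mul hJ.le,
      mul_one_div_cancel ha.ne', Real.rpow_one]
    congr 2; field_simp
  calc _ ≤ I * J ^ (1 / (a / (1 - a))) * J ^ (-(1 / (a / (1 - a)))) := by
        rw [← h5]; gcongr
    _ = I := by rw [mul_assoc, ← Real.rpow_add hJ, add_neg_cancel, Real.rpow_zero, mul_one]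

section Cell

variable {E : Type*} [MeasurableSpace E] [Zero E]

/-- The law of `(Y, B Y)` with `Y` of law `μ` and `B` an independent Bernoulli variable of
parameter `r`. -/
noncomputable def thinnedPair (μ : Measure E) (r : ℝ) : Measure (E × E) :=
  ENNReal.ofReal r • μ.map (fun y => (y, y)) + ENNReal.ofReal (1 - r) • μ.map (fun y => (y, 0))

omit [Zero E] in
lemma measurable_diag_pair : Measurable fun y : E => (y, y) := measurable_id.prodMk measurable_id

lemma measurable_zero_pair : Measurable fun y : E => (y, (0 : E)) :=
  measurable_id.prodMk measurable_const

lemma isProbabilityMeasure_thinnedPair (μ : Measure E) [IsProbabilityMeasure μ] {r : ℝ}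
    (hr : 0 ≤ r) (hr1 : r ≤ 1) : IsProbabilityMeasure (thinnedPair μ r) := by
  constructor
  rw [thinnedPair, Measure.add_apply, Measure.smul_apply, Measure.smul_apply,
    Measure.map_apply measurable_diag_pair .univ, Measure.map_apply measurable_zero_pair .univ,
    preimage_univ, preimage_univ, measure_univ, smul_eq_mul, smul_eq_mul, mul_one, mul_one,
    ← ENNReal.ofReal_add hr (by linarith)]
  simp

lemma integral_thinnedPair (μ : Measure E) [IsProbabilityMeasure μ] {r : ℝ}
    (hr : 0 ≤ r) (hr1 : r ≤ 1) {F : E × E → ℝ} (hF : BddPos F) :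
    ∫ p, F p ∂(thinnedPair μ r) = r * ∫ y, F (y, y) ∂μ + (1 - r) * ∫ y, F (y, 0) ∂μ := by
  have i1 : Integrable F (μ.map fun y => (y, y)) := hF.integrable _
  have i2 : Integrable F (μ.map fun y => (y, (0 : E))) := hF.integrable _
  rw [thinnedPair, integral_add_measure (i1.smul_measure ENNReal.ofReal_ne_top)
    (i2.smul_measure ENNReal.ofReal_ne_top), integral_smul_measure, integral_smul_measure,
    integral_map measurable_diag_pair.aemeasurable hF.1.aestronglyMeasurable,
    integral_map measurable_zero_pair.aemeasurable hF.1.aestronglyMeasurable,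
    ENNReal.toReal_ofReal hr, ENNReal.toReal_ofReal (by linarith), smul_eq_mul, smul_eq_mul]

/-- Averaging over the Bernoulli variable replaces h(BY) by r h(Y) + (1-r) h(0). Reverse Hölder
against f then leaves an inequality between two norms of h alone. Both sides are homogeneous of
degree one in h, which allows the normalisation h(0) = 1. -/
lemma ReverseHC.thinnedPair_of_norm_le (μ : Measure E) [IsProbabilityMeasure μ] {r a b K : ℝ}
    (hr : 0 ≤ r) (hr1 : r ≤ 1) (ha : 0 < a) (ha1 : a < 1) (hb : 0 < b) (hK : 0 ≤ K)
    (H : ∀ h : E → ℝ, BddPos h → h 0 = 1 →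
      (∫ y, (r * h y + (1 - r)) ^ (-(a / (1 - a))) ∂μ) ^ (1 / (a / (1 - a))) ≤
        K * (r * (∫ y, h y ^ (-b) ∂μ) + (1 - r)) ^ (1 / b)) :
    ReverseHC (thinnedPair μ r) a b K := by
  have main : ∀ f h : E → ℝ, BddPos f → BddPos h → h 0 = 1 →
      (∫ p, f p.1 ^ a ∂(thinnedPair μ r)) ^ (1 / a) *
        (∫ p, h p.2 ^ (-b) ∂(thinnedPair μ r)) ^ (-(1 / b)) ≤
      K * ∫ p, f p.1 * h p.2 ∂(thinnedPair μ r) := by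
    intro f h hf hh h0
    have hfh : BddPos (fun p : E × E => f p.1 * h p.2) :=
      (hf.comp measurable_fst).mul (hh.comp measurable_snd)
    rw [integral_thinnedPair μ hr hr1 ((hf.rpow a).comp measurable_fst),
      integral_thinnedPair μ hr hr1 ((hh.rpow (-b)).comp measurable_snd),
      integral_thinnedPair μ hr hr1 hfh]
    have hP : BddPos (fun y => r * h y + (1 - r)) := by
      obtain ⟨hm, c, C, hc, hcC⟩ := hh
      have hc1 : c ≤ 1 := h0 ▸ (hcC 0).1
      refine ⟨(hm.const_mul r).add_const _, c, r * C + (1 - r), hc, fun x => ⟨?_, ?_⟩⟩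
      · nlinarith [mul_le_mul_of_nonneg_left (hcC x).1 hr]
      · nlinarith [mul_le_mul_of_nonneg_left (hcC x).2 hr]
    have e1 : r * ∫ y, f y * h y ∂μ + (1 - r) * ∫ y, f y * h 0 ∂μ
        = ∫ y, f y * (r * h y + (1 - r)) ∂μ := by
      rw [h0, ← integral_const_mul, ← integral_const_mul, ← integral_add]
      · congr 1; ext y; ring
      · exact ((hf.mul hh).integrable μ).const_mul r
      · simpa using (hf.integrable μ).const_mul (1 - r)
    have e2 : r * ∫ y, f y ^ a ∂μ + (1 - r) * ∫ y, f y ^ a ∂μ = ∫ y, f y ^ a ∂μ := by ring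
    simp only [e1, e2]
    have e3 : ∫ _ : E, h 0 ^ (-b) ∂μ = 1 := by simp [h0]
    rw [e3, mul_one]
    have RH := reverse_holder μ ha ha1 hf hP
    have HH := H h hh h0
    set X := ∫ y, (r * h y + (1 - r)) ^ (-(a / (1 - a))) ∂μ
    have hX : 0 < X := (hP.rpow _).integral_pos μ
    set V := ∫ y, h y ^ (-b) ∂μ
    have hV : 0 < V := (hh.rpow _).integral_pos μ
    have hY : 0 < r * V + (1 - r) := by
      rcases hr.eq_or_lt with rfl | hr0
      · simp
      · have := mul_pos hr0 hV; linarith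
    have h7 : (r * V + (1 - r)) ^ (-(1 / b)) ≤ K * X ^ (-(1 / (a / (1 - a)))) := by
      rw [Real.rpow_neg hY.le, Real.rpow_neg hX.le, ← div_eq_mul_inv, inv_eq_one_div,
        div_le_div_iff₀ (by positivity) (by positivity), one_mul]
      exact HH
    calc _ ≤ (∫ y, f y ^ a ∂μ) ^ (1 / a) * (K * X ^ (-(1 / (a / (1 - a))))) :=
          mul_le_mul_of_nonneg_left h7 (Real.rpow_nonneg ((hf.rpow a).integral_pos μ).le _)
      _ = K * ((∫ y, f y ^ a ∂μ) ^ (1 / a) * X ^ (-(1 / (a / (1 - a))))) := by ring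
      _ ≤ _ := mul_le_mul_of_nonneg_left RH hK
  intro f h hf hh
  have h0 := hh.pos 0
  -- Undo the normalisation by scaling h with 1/h(0).
  have hk : BddPos (fun y => (h 0)⁻¹ * h y) := (BddPos.const (inv_pos.2 h0)).mul hh
  have hm := main f _ hf hk (inv_mul_cancel₀ h0.ne')
  have := isProbabilityMeasure_thinnedPair μ hr hr1
  have hI : 0 < ∫ p, h p.2 ^ (-b) ∂(thinnedPair μ r) :=
    ((hh.rpow (-b)).comp measurable_snd).integral_pos _
  have e4 : ∀ p : E × E, ((h 0)⁻¹ * h p.2) ^ (-b) = ((h 0)⁻¹) ^ (-b) * h p.2 ^ (-b) := fun p =>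
    Real.mul_rpow (inv_pos.2 h0).le (hh.pos _).le
  have e5 : ∀ p : E × E, f p.1 * ((h 0)⁻¹ * h p.2) = (h 0)⁻¹ * (f p.1 * h p.2) := fun p => by ring
  simp only [e4, e5, integral_const_mul] at hm
  rw [Real.mul_rpow (by positivity) hI.le, ← Real.rpow_mul (by positivity), neg_mul_neg,
    mul_one_div_cancel hb.ne', Real.rpow_one] at hm
  refine le_of_mul_le_mul_left ?_ (inv_pos.2 h0)
  calc _ = _ := by ring
    _ ≤ _ := hm
    _ = _ := by ring

/-- AM-GM in the form x^r ≤ r x + (1-r) is used twice: at x = h(y) under the integral, where b = rα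
turns h^(-rα) into h^(-b), and at x = ∫ h^(-b) outside it. -/
lemma ReverseHC.thinnedPair_one (μ : Measure E) [IsProbabilityMeasure μ] {r a b : ℝ}
    (hr : 0 < r) (hr1 : r ≤ 1) (ha : 0 < a) (ha1 : a < 1) (hb : b = r * (a / (1 - a))) :
    ReverseHC (thinnedPair μ r) a b 1 := by
  have hα : 0 < a / (1 - a) := div_pos ha (by linarith)
  have hb0 : 0 < b := hb ▸ mul_pos hr hα
  refine ReverseHC.thinnedPair_of_norm_le μ hr.le hr1 ha ha1 hb0 zero_le_one fun h hh h0 => ?_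
  set α := a / (1 - a)
  have amgm : ∀ {x : ℝ}, 0 ≤ x → x ^ r ≤ r * x + (1 - r) := fun {x} hx => by
    simpa using Real.geom_mean_le_arith_mean2_weighted hr.le (sub_nonneg.2 hr1) hx zero_le_one
      (by ring)
  have hle : ∀ y, (r * h y + (1 - r)) ^ (-α) ≤ h y ^ (-b) := fun y => by
    have := hh.pos y
    calc _ ≤ (h y ^ r) ^ (-α) := Real.rpow_le_rpow_of_nonpos (by positivity) (amgm this.le)
          (by linarith)
      _ = _ := by rw [← Real.rpow_mul this.le, hb]; congr 1; ring
  have hV : 0 < ∫ y, h y ^ (-b) ∂μ := (hh.rpow _).integral_pos μ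
  set V := ∫ y, h y ^ (-b) ∂μ
  have hU0 : 0 ≤ ∫ y, (r * h y + (1 - r)) ^ (-α) ∂μ := integral_nonneg fun y =>
    Real.rpow_nonneg (by have := mul_pos hr (hh.pos y); linarith) _
  have hU : ∫ y, (r * h y + (1 - r)) ^ (-α) ∂μ ≤ V :=
    integral_mono_of_nonneg (Eventually.of_forall fun y =>
      Real.rpow_nonneg (by have := mul_pos hr (hh.pos y); linarith) _)
      ((hh.rpow (-b)).integrable μ) (Eventually.of_forall hle)
  rw [one_mul]
  calc _ ≤ V ^ (1 / α) := Real.rpow_le_rpow hU0 hU (by positivity)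
    _ = (V ^ r) ^ (1 / b) := by
        rw [← Real.rpow_mul hV.le, hb]; congr 1; field_simp
    _ ≤ _ := Real.rpow_le_rpow (by positivity) (amgm hV.le) (by positivity)

end Cell

/-! ### The one-cell inequality when Y has a large atom at 0 -/

/-- The constant αr/β is the one for which the first-order contributions of the off-atom integrals
cancel in `rpow_atom_add_le`. The proof is weighted AM-GM with weights β/α and 1 - β/α, followed by
a check that the resulting constant does not exceed αr/β. -/
lemma rpow_neg_affine_le {α β r y : ℝ} (hβ : 0 < β) (hαβ : β < α) (hr : r = (1 + β) / (1 + α))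
    (hy : 0 < y) : (r * y + (1 - r)) ^ (-α) ≤ α * r / β * y ^ (-β) := by
  have hα : 0 < α := hβ.trans hαβ
  have hr0 : 0 < r := by rw [hr]; positivity
  have hr' : 1 - r = (α - β) / (1 + α) := by rw [hr]; field_simp; ring
  have hsub : 0 < α - β := by linarith
  have hr1 : 0 < 1 - r := by rw [hr']; positivity
  have hw : 1 - β / α = (α - β) / α := by field_simp
  have hw1 : 0 < 1 - β / α := by rw [hw]; positivity
  -- u and v are the likelihood ratios r/(β/α) and (1-r)/(1-β/α), so the weighted mean of u y and v
  -- is exactly r y + (1-r).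
  set u := α * r / β with hu
  have hu0 : 0 < u := by positivity
  set v := α / (1 + α) with hv
  have hv0 : 0 < v := by positivity
  have amgm := Real.geom_mean_le_arith_mean2_weighted (w₁ := β / α) (w₂ := 1 - β / α)
    (p₁ := u * y) (p₂ := v) (by positivity) hw1.le (by positivity) hv0.le (by ring)
  have e1 : β / α * (u * y) + (1 - β / α) * v = r * y + (1 - r) := by
    rw [hw, hr', hu, hv]; field_simp
  rw [e1] at amgm
  -- Up to the factor 1+α, this is nonnegativity of the relative entropy of Bernoulli(r) with
  -- respect to Bernoulli(β/α).
  have kl : 0 ≤ (1 + β) * Real.log u + (α - β) * Real.log v := by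
    have h1 := Real.one_sub_inv_le_log_of_pos hu0
    have h2 := Real.one_sub_inv_le_log_of_pos hv0
    have h3 : (1 + β) * (1 - u⁻¹) + (α - β) * (1 - v⁻¹) = 0 := by
      rw [hu, hv, hr]; field_simp; ring
    nlinarith [mul_le_mul_of_nonneg_left h1 (by positivity : (0 : ℝ) ≤ 1 + β),
      mul_le_mul_of_nonneg_left h2 hsub.le]
  have hP : 0 < r * y + (1 - r) := by positivity
  have hlog := Real.log_le_log (by positivity) amgm
  rw [Real.log_mul (by positivity) (by positivity), Real.log_rpow (by positivity),
    Real.log_rpow hv0, Real.log_mul hu0.ne' hy.ne', hw] at hlog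
  rw [← Real.log_le_log_iff (by positivity) (by positivity),
    Real.log_mul hu0.ne' (by positivity), Real.log_rpow hP, Real.log_rpow hy]
  have h6 := mul_le_mul_of_nonneg_left hlog hα.le
  have h7 : α * (β / α * (Real.log u + Real.log y) + (α - β) / α * Real.log v)
      = β * (Real.log u + Real.log y) + (α - β) * Real.log v := by field_simp
  rw [h7] at h6
  nlinarith

lemma exp_le_one_add {z : ℝ} (hz : -(1 / 2) ≤ z) : Real.exp (z - 2 * z ^ 2) ≤ 1 + z := by
  have h1 := Real.one_sub_le_exp_neg (z - 2 * z ^ 2)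
  have h2 : 0 < 1 - (z - 2 * z ^ 2) := by nlinarith [sq_nonneg (z - 1 / 4)]
  have h3 : 1 ≤ (1 + z) * (1 - (z - 2 * z ^ 2)) := by nlinarith [sq_nonneg z]
  have h4 : (1 : ℝ) ≤ (1 + z) * Real.exp (-(z - 2 * z ^ 2)) := by
    refine h3.trans (mul_le_mul_of_nonneg_left h1 (by linarith))
  rw [Real.exp_neg, ← div_eq_mul_inv, one_le_div (Real.exp_pos _)] at h4
  exact h4

/-- The scalar estimate behind the two-point inequality with an atom of mass `m ≥ 1 - p`. -/
lemma rpow_atom_add_le {α β r m p U V Q : ℝ} (hβ : 0 < β) (hαβ : β < α)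
    (hr : r = (1 + β) / (1 + α)) (hm1 : m ≤ 1) (hmp : 1 - p ≤ m) (hU : 0 ≤ U) (hm : 0 ≤ m)
    (hUV : U ≤ α * r / β * V) (hQ : r * (1 - m) + β / α * U ≤ Q * (1 - m)) (hQ0 : 0 ≤ Q)
    (hQp : Q * p ≤ 1 / 2) :
    (m + U) ^ (1 / α) ≤ Real.exp (p * (r / β - 1 / α) + 2 * Q ^ 2 / β * p ^ 2) *
      (r * (m + V) + (1 - r)) ^ (1 / β) := by
  have hα : 0 < α := hβ.trans hαβ
  have hr0 : 0 < r := by rw [hr]; positivity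
  -- 1 + z is a lower bound for the base on the right. In (U-(1-m))/α - z/β the terms U/α cancel,
  -- leaving (1-m)(r/β - 1/α); only the quadratic error 2z²/β remains.
  set z := -(r * (1 - m)) + β / α * U with hz
  have hq : 0 ≤ 1 - m := by linarith
  have hqp : 1 - m ≤ p := by linarith
  have hU' : 0 ≤ β / α * U := by positivity
  have hrq : 0 ≤ r * (1 - m) := by positivity
  have hQm : Q * (1 - m) ≤ Q * p := mul_le_mul_of_nonneg_left hqp hQ0
  have hzabs : |z| ≤ Q * p := by rw [abs_le]; constructor <;> linarith
  have hz2 : z ^ 2 ≤ Q ^ 2 * p ^ 2 := by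
    rw [← mul_pow, ← sq_abs z]; exact pow_le_pow_left₀ (abs_nonneg _) hzabs 2
  have hzl : -(1 / 2) ≤ z := by have := (abs_le.1 hzabs).1; linarith
  have h1 : m + U ≤ Real.exp (U - (1 - m)) := by
    have := Real.add_one_le_exp (U - (1 - m)); linarith
  have h2 : 1 + z ≤ r * (m + V) + (1 - r) := by
    have : β / α * U ≤ r * V := by
      calc _ ≤ β / α * (α * r / β * V) := by gcongr
        _ = r * V := by field_simp
    rw [hz]; nlinarith
  have h3 := (exp_le_one_add hzl).trans h2
  calc (m + U) ^ (1 / α) ≤ Real.exp (U - (1 - m)) ^ (1 / α) :=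
        Real.rpow_le_rpow (by positivity) h1 (by positivity)
    _ = Real.exp ((U - (1 - m)) * (1 / α)) := by rw [← Real.exp_mul]
    _ ≤ Real.exp (p * (r / β - 1 / α) + 2 * Q ^ 2 / β * p ^ 2 + (z - 2 * z ^ 2) * (1 / β)) := by
        rw [Real.exp_le_exp]
        have h4 : 0 ≤ r / β - 1 / α := by
          rw [hr, sub_nonneg, div_div, div_le_div_iff₀ hα (by positivity)]; nlinarith
        have h5 : (1 - m) * (r / β - 1 / α) ≤ p * (r / β - 1 / α) :=
          mul_le_mul_of_nonneg_right hqp h4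
        have h6 : z ^ 2 / β ≤ Q ^ 2 * p ^ 2 / β := by gcongr
        have h7 : (z - 2 * z ^ 2) * (1 / β)
            = -((1 - m) * (r / β)) + U / α - 2 * (z ^ 2 / β) := by
          rw [hz]; field_simp
        rw [h7]
        have h8 : 2 * Q ^ 2 / β * p ^ 2 = 2 * (Q ^ 2 * p ^ 2 / β) := by ring
        have h9 : (U - (1 - m)) * (1 / α) = U / α - (1 - m) * (1 / α) := by ring
        rw [h8, h9]
        nlinarith
    _ = Real.exp (p * (r / β - 1 / α) + 2 * Q ^ 2 / β * p ^ 2) *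
          Real.exp (z - 2 * z ^ 2) ^ (1 / β) := by rw [Real.exp_add, ← Real.exp_mul]
    _ ≤ _ := by gcongr

lemma integral_eq_atom_add {E : Type*} [MeasurableSpace E] [MeasurableSingletonClass E]
    (μ : Measure E) [IsFiniteMeasure μ] (x : E) {g : E → ℝ} (hg : Integrable g μ) :
    ∫ y, g y ∂μ = μ.real {x} * g x + ∫ y in {x}ᶜ, g y ∂μ := by
  rw [← integral_add_compl (measurableSet_singleton x) hg, integral_singleton, smul_eq_mul]

/-- M and p₀ depend on the exponents only, not on μ. This matters because the law of the cell
changes with n, and M p² must be negligible after n-fold iteration. -/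
lemma ReverseHC.exists_thinnedPair_atom (E : Type*) [MeasurableSpace E] [Zero E]
    [MeasurableSingletonClass E] {a b r : ℝ}
    (ha : 0 < a) (ha1 : a < 1) (hb : 0 < b) (hba : b < a / (1 - a))
    (hr : r = (1 + b) / (1 + a / (1 - a))) :
    ∃ M p₀ : ℝ, 0 < p₀ ∧ ∀ μ : Measure E, IsProbabilityMeasure μ → ∀ p, 0 ≤ p → p ≤ p₀ →
      1 - p ≤ μ.real {0} →
      ReverseHC (thinnedPair μ r) a b
        (Real.exp (p * (r / b - 1 / (a / (1 - a))) + M * p ^ 2)) := by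
  set α := a / (1 - a) with hαdef
  have hα : 0 < α := hb.trans hba
  have hr0 : 0 < r := by rw [hr]; positivity
  have hr1 : r < 1 := by rw [hr, div_lt_one (by positivity)]; linarith
  -- Since r h + (1-r) ≥ 1-r, D bounds the left integrand pointwise, whatever h is. Hence the
  -- off-atom integral is at most D(1-m).
  set D := (1 - r) ^ (-α)
  have hD : 0 < D := Real.rpow_pos_of_pos (by linarith) _
  set Q := r + b / α * D with hQ
  have hQ0 : 0 < Q := by positivity
  refine ⟨2 * Q ^ 2 / b, 1 / (2 * Q), by positivity, fun μ hμ p hp hpp hmp => ?_⟩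
  refine ReverseHC.thinnedPair_of_norm_le μ hr0.le hr1.le ha ha1 hb (Real.exp_pos _).le
    fun h hh h0 => ?_
  rw [← hαdef]
  have hP : BddPos (fun y => r * h y + (1 - r)) :=
    ((BddPos.const hr0).mul hh).add (BddPos.const (by linarith))
  rw [integral_eq_atom_add μ 0 ((hP.rpow (-α)).integrable μ),
    integral_eq_atom_add μ 0 ((hh.rpow (-b)).integrable μ), h0]
  have e1 : (r * 1 + (1 - r)) ^ (-α) = 1 := by
    rw [show r * 1 + (1 - r) = 1 by ring, Real.one_rpow]
  rw [e1, Real.one_rpow, mul_one]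
  have hpt := fun y => rpow_neg_affine_le hb hba hr (hh.pos y)
  refine rpow_atom_add_le hb hba hr measureReal_le_one hmp
    (integral_nonneg fun y => ((hP.rpow (-α)).pos y).le) measureReal_nonneg ?_ ?_ hQ0.le ?_
  · rw [← integral_const_mul]
    exact integral_mono ((hP.rpow (-α)).integrable _) (((hh.rpow (-b)).integrable _).const_mul _)
      hpt
  · have : ∫ y in {0}ᶜ, (r * h y + (1 - r)) ^ (-α) ∂μ ≤ D * (1 - μ.real {0}) := by
      calc _ ≤ ∫ y in {0}ᶜ, D ∂μ := by
            refine integral_mono ((hP.rpow (-α)).integrable _) (integrable_const _) fun y => ?_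
            refine Real.rpow_le_rpow_of_nonpos (by linarith) ?_ (by linarith)
            have := mul_pos hr0 (hh.pos y)
            linarith
        _ = D * (1 - μ.real {0}) := by
            rw [setIntegral_const, probReal_compl_eq_one_sub (measurableSet_singleton _),
              smul_eq_mul, mul_comm]
    rw [hQ, add_mul, mul_assoc (b / α)]
    gcongr
  · calc Q * p ≤ Q * (1 / (2 * Q)) := by gcongr
      _ = 1 / 2 := by field_simp

/-! ### Binomial expansion of convolution powers -/

lemma conv_prod_prod {M N : Type*} [AddCommMonoid M] [AddCommMonoid N] [MeasurableSpace M]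
    [MeasurableSpace N] [MeasurableAdd₂ M] [MeasurableAdd₂ N] (μ μ' : Measure M) (ν ν' : Measure N)
    [SFinite μ] [SFinite μ'] [SFinite ν] [SFinite ν'] :
    (μ.prod ν).conv (μ'.prod ν') = (μ.conv μ').prod (ν.conv ν') := by
  refine Measure.ext_of_lintegral _ fun F hF => ?_
  rw [Measure.lintegral_conv hF, lintegral_prod _ (by fun_prop), lintegral_prod _ hF.aemeasurable,
    Measure.lintegral_conv (by fun_prop)]
  refine lintegral_congr fun x => ?_
  have h1 : ∀ y, ∫⁻ p, F ((x, y) + p) ∂(μ'.prod ν') =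
      ∫⁻ x', ∫⁻ y', F (x + x', y + y') ∂ν' ∂μ' := fun y => by
    rw [lintegral_prod _ (by fun_prop)]; rfl
  have h2 : ∀ x', ∫⁻ y, F (x + x', y) ∂(ν.conv ν') =
      ∫⁻ y, ∫⁻ y', F (x + x', y + y') ∂ν' ∂ν := fun x' =>
    Measure.lintegral_conv (f := fun y => F (x + x', y)) (by fun_prop)
  simp only [h1, h2]
  refine lintegral_lintegral_swap ?_
  exact (Measurable.lintegral_prod_right' (ν := ν')
    (f := fun q : (N × M) × N => F (x + q.1.2, q.1.1 + q.2)) (by fun_prop)).aemeasurable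

/-- Expansion of the iterates of a weighted Pascal recursion. -/
lemma pascal_recursion {r : ℝ} {G : ℕ → ℕ → ℕ → ℝ}
    (hG : ∀ j m l, G (j + 1) m l = r * G j (m + 1) l + (1 - r) * G j m (l + 1)) (n m l : ℕ) :
    G n m l = ∑ i ∈ Finset.range (n + 1),
      (n.choose i : ℝ) * r ^ i * (1 - r) ^ (n - i) * G 0 (m + i) (l + (n - i)) := by
  -- The two index shifts commute, so the recursion is solved by the binomial theorem for (r A +
  -- (1-r) B)^n.
  let A : Module.End ℝ (ℕ → ℕ → ℝ) :=
    { toFun := fun g m l => g (m + 1) l, map_add' := fun _ _ => rfl, map_smul' := fun _ _ => rfl }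
  let B : Module.End ℝ (ℕ → ℕ → ℝ) :=
    { toFun := fun g m l => g m (l + 1), map_add' := fun _ _ => rfl, map_smul' := fun _ _ => rfl }
  have hA : ∀ i g m l, (A ^ i) g m l = g (m + i) l := by
    intro i
    induction i with
    | zero => intro g m l; rfl
    | succ i ih =>
      intro g m l
      rw [pow_succ, Module.End.mul_apply, ih]; rfl
  have hB : ∀ i g m l, (B ^ i) g m l = g m (l + i) := by
    intro i
    induction i with
    | zero => intro g m l; rfl
    | succ i ih =>
      intro g m l
      rw [pow_succ, Module.End.mul_apply, ih]; rfl
  have hcomm : Commute (r • A) ((1 - r) • B) := by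
    have : Commute A B := rfl
    exact (this.smul_left r).smul_right (1 - r)
  have hpow : ∀ j, G j = ((r • A + (1 - r) • B) ^ j) (G 0) := by
    intro j
    induction j with
    | zero => rfl
    | succ j ih =>
      rw [pow_succ', Module.End.mul_apply, ← ih]
      funext m l
      exact hG j m l
  rw [hpow n, hcomm.add_pow]
  simp only [LinearMap.sum_apply, Finset.sum_apply]
  refine Finset.sum_congr rfl fun i _ => ?_
  rw [(Nat.cast_commute (n.choose i) _).symm.eq]
  simp only [smul_pow, Module.End.mul_apply, LinearMap.smul_apply, Pi.smul_apply, smul_eq_mul,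
    map_smul, ← nsmul_eq_mul, hA, hB]
  simp only [nsmul_eq_mul]
  ring

/-- A convolution semigroup of probability measures that concentrates at `0` as `t → 0`. -/
structure ConvolutionFamily {E : Type*} [NormedAddCommGroup E] [MeasurableSpace E]
    (μ : ℝ → Measure E) : Prop where
  prob : ∀ t, 0 ≤ t → IsProbabilityMeasure (μ t)
  zero : μ 0 = Measure.dirac 0
  add : ∀ s t, 0 ≤ s → 0 ≤ t → μ (s + t) = (μ s).conv (μ t)
  small : ∀ η : ℝ, 0 < η → Tendsto (fun t => (μ t).real {y | η ≤ ‖y‖}) (𝓝[>] 0) (𝓝 0)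

/-! ### The coupling (X_{v+w}, X_v) as a limit of sums of thinned cells -/

section PairLaw

variable {E : Type*} [NormedAddCommGroup E] [MeasurableSpace E] [BorelSpace E]
  [SecondCountableTopology E] {μ : ℝ → Measure E}

/-- The law of `(X_{v+w}, X_v)` for a process with stationary independent increments of laws
`μ`. -/
noncomputable def pairLaw (μ : ℝ → Measure E) (v w : ℝ) : Measure (E × E) :=
  ((μ v).prod (μ w)).map (fun p => (p.1 + p.2, p.1))

lemma measurable_pairMap : Measurable (fun p : E × E => (p.1 + p.2, p.1)) := by fun_prop

lemma ConvolutionFamily.prob_pairLaw (hμ : ConvolutionFamily μ) {v w : ℝ} (hv : 0 ≤ v)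
    (hw : 0 ≤ w) : IsProbabilityMeasure (pairLaw μ v w) := by
  have := hμ.prob v hv
  have := hμ.prob w hw
  exact Measure.isProbabilityMeasure_map measurable_pairMap.aemeasurable

lemma ConvolutionFamily.pairLaw_conv (hμ : ConvolutionFamily μ) {v w v' w' : ℝ} (hv : 0 ≤ v)
    (hw : 0 ≤ w) (hv' : 0 ≤ v') (hw' : 0 ≤ w') :
    (pairLaw μ v w).conv (pairLaw μ v' w') = pairLaw μ (v + v') (w + w') := by
  have := hμ.prob v hv
  have := hμ.prob w hw
  have := hμ.prob v' hv'
  have := hμ.prob w' hw'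
  let L : E × E →+ E × E :=
    { toFun := fun p => (p.1 + p.2, p.1)
      map_zero' := by simp
      map_add' := fun p q => by
        simp only [Prod.fst_add, Prod.snd_add, Prod.mk_add_mk, Prod.mk.injEq, and_true]; abel }
  have hL : Measurable L := measurable_pairMap
  change (Measure.map L _).conv (Measure.map L _) = Measure.map L _
  rw [← Measure.map_conv_addMonoidHom L hL, conv_prod_prod, hμ.add v v' hv hv',
    hμ.add w w' hw hw']

lemma ConvolutionFamily.pairLaw_zero_right (hμ : ConvolutionFamily μ) {v : ℝ} (hv : 0 ≤ v) :
    pairLaw μ v 0 = (μ v).map (fun y => (y, y)) := by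
  have := hμ.prob v hv
  rw [pairLaw, hμ.zero, Measure.prod_dirac, Measure.map_map (by fun_prop) (by fun_prop)]
  congr 1; ext y <;> simp

lemma ConvolutionFamily.pairLaw_zero_left (hμ : ConvolutionFamily μ) {w : ℝ} (hw : 0 ≤ w) :
    pairLaw μ 0 w = (μ w).map (fun y => (y, 0)) := by
  have := hμ.prob w hw
  rw [pairLaw, hμ.zero, Measure.dirac_prod, Measure.map_map (by fun_prop) (by fun_prop)]
  congr 1; ext y <;> simp

/-- A cell is a mixture of the couplings (Y, Y) and (Y, 0), that is, of `pairLaw μ d 0` and `pairLaw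
μ 0 d`. Adding it advances either the common part or the extra part by d. -/
lemma ConvolutionFamily.pairLaw_conv_thinnedPair (hμ : ConvolutionFamily μ) {v w d r : ℝ}
    (hv : 0 ≤ v) (hw : 0 ≤ w) (hd : 0 ≤ d) :
    (pairLaw μ v w).conv (thinnedPair (μ d) r) =
      ENNReal.ofReal r • pairLaw μ (v + d) w + ENNReal.ofReal (1 - r) • pairLaw μ v (w + d) := by
  have := hμ.prob_pairLaw hv hw
  have := hμ.prob_pairLaw hd le_rfl
  have := hμ.prob_pairLaw le_rfl hd
  rw [thinnedPair, ← hμ.pairLaw_zero_right hd, ← hμ.pairLaw_zero_left hd, Measure.conv_add,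
    Measure.conv_smul_right, Measure.conv_smul_right, hμ.pairLaw_conv hv hw hd le_rfl,
    hμ.pairLaw_conv hv hw le_rfl hd, add_zero, add_zero]

lemma ConvolutionFamily.integral_convPow (hμ : ConvolutionFamily μ) {d r : ℝ} (hd : 0 ≤ d)
    (hr : 0 ≤ r) (hr1 : r ≤ 1) {F : E × E → ℝ} (hF : BddPos F) (n : ℕ) :
    ∫ p, F p ∂(convPow (thinnedPair (μ d) r) n) = ∑ i ∈ Finset.range (n + 1),
      (n.choose i : ℝ) * r ^ i * (1 - r) ^ (n - i) *
        ∫ p, F p ∂(pairLaw μ (i * d) ((n - i : ℕ) * d)) := by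
  have := hμ.prob d hd
  have hκ := isProbabilityMeasure_thinnedPair (μ d) hr hr1
  set κ := thinnedPair (μ d) r
  -- Index by the numbers m and l of cells already assigned to the common and extra parts, with j
  -- cells still undecided; start from m = l = 0.
  have key := pascal_recursion (r := r)
    (G := fun j m l => ∫ p, F p ∂((pairLaw μ (m * d) (l * d)).conv (convPow κ j))) (by
      intro j m l
      have h1 : (0 : ℝ) ≤ m * d := by positivity
      have h2 : (0 : ℝ) ≤ l * d := by positivity
      have h3 : (0 : ℝ) ≤ (m + 1 : ℕ) * d := by positivity
      have h4 : (0 : ℝ) ≤ (l + 1 : ℕ) * d := by positivity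
      have := hμ.prob_pairLaw h1 h2
      have := hμ.prob_pairLaw h3 h2
      have := hμ.prob_pairLaw h1 h4
      have e1 : (m : ℝ) * d + d = (m + 1 : ℕ) * d := by push_cast; ring
      have e2 : (l : ℝ) * d + d = (l + 1 : ℕ) * d := by push_cast; ring
      have e : (pairLaw μ (m * d) (l * d)).conv (convPow κ (j + 1)) =
          ENNReal.ofReal r • (pairLaw μ ((m + 1 : ℕ) * d) (l * d)).conv (convPow κ j) +
          ENNReal.ofReal (1 - r) • (pairLaw μ (m * d) ((l + 1 : ℕ) * d)).conv (convPow κ j) := by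
        rw [convPow, Measure.conv_comm (convPow κ j) κ, ← Measure.conv_assoc,
          hμ.pairLaw_conv_thinnedPair h1 h2 hd, e1, e2, Measure.add_conv, Measure.conv_smul_left,
          Measure.conv_smul_left]
      simp only [e]
      rw [integral_add_measure ((hF.integrable _).smul_measure ENNReal.ofReal_ne_top)
        ((hF.integrable _).smul_measure ENNReal.ofReal_ne_top), integral_smul_measure,
        integral_smul_measure, ENNReal.toReal_ofReal hr, ENNReal.toReal_ofReal (by linarith),
        smul_eq_mul, smul_eq_mul]) n 0 0
  have e0 : pairLaw μ 0 0 = Measure.dirac 0 := by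
    rw [hμ.pairLaw_zero_right le_rfl, hμ.zero, Measure.map_dirac' (by fun_prop)]; rfl
  simp only [Nat.cast_zero, zero_mul, e0, Measure.dirac_zero_conv, zero_add] at key
  rw [key]
  refine Finset.sum_congr rfl fun i _ => ?_
  have := hμ.prob_pairLaw (v := i * d) (w := (n - i : ℕ) * d) (by positivity) (by positivity)
  rw [convPow, Measure.conv_dirac_zero]

/-- The two laws differ by a single increment c of law μ_d, which enters as (c, c) in one and as (c,
0) in the other. For ‖c‖ < η the modulus of continuity applies; otherwise the difference is at most
C. -/
lemma ConvolutionFamily.abs_integral_pairLaw_sub_le (hμ : ConvolutionFamily μ) {v w d : ℝ}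
    (hv : 0 ≤ v) (hw : 0 ≤ w) (hd : 0 ≤ d) {F : E × E → ℝ} (hF : BddPos F) {C ε η : ℝ}
    (hC : ∀ p, F p ≤ C) (hε : 0 ≤ ε)
    (hη : ∀ p q : E × E, dist p q < η → |F p - F q| ≤ ε) :
    |∫ p, F p ∂(pairLaw μ (v + d) w) - ∫ p, F p ∂(pairLaw μ v (w + d))| ≤
      ε + C * (μ d).real {y | η ≤ ‖y‖} := by
  have := hμ.prob_pairLaw hv hw
  have := hμ.prob_pairLaw hd le_rfl
  have := hμ.prob_pairLaw le_rfl hd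
  have := hμ.prob d hd
  have hC0 : 0 ≤ C := (hF.pos 0).le.trans (hC 0)
  have e1 : pairLaw μ (v + d) w = (pairLaw μ v w).conv (pairLaw μ d 0) := by
    rw [hμ.pairLaw_conv hv hw hd le_rfl, add_zero]
  have e2 : pairLaw μ v (w + d) = (pairLaw μ v w).conv (pairLaw μ 0 d) := by
    rw [hμ.pairLaw_conv hv hw le_rfl hd, add_zero]
  have hF1 : BddPos fun q : (E × E) × E => F (q.1 + (q.2, q.2)) := hF.comp (by fun_prop)
  have hF2 : BddPos fun q : (E × E) × E => F (q.1 + (q.2, 0)) := hF.comp (by fun_prop)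
  have i1 : ∫ p, F p ∂(pairLaw μ (v + d) w) =
      ∫ p, ∫ c, F (p + (c, c)) ∂(μ d) ∂(pairLaw μ v w) := by
    rw [e1, Measure.integral_conv_eq hF.1 (hF.integrable _), hμ.pairLaw_zero_right hd]
    refine integral_congr_ae (Eventually.of_forall fun p => ?_)
    exact integral_map (by fun_prop) (hF.comp (φ := fun q => p + q)
      (by fun_prop)).1.aestronglyMeasurable
  have i2 : ∫ p, F p ∂(pairLaw μ v (w + d)) =
      ∫ p, ∫ c, F (p + (c, 0)) ∂(μ d) ∂(pairLaw μ v w) := by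
    rw [e2, Measure.integral_conv_eq hF.1 (hF.integrable _), hμ.pairLaw_zero_left hd]
    refine integral_congr_ae (Eventually.of_forall fun p => ?_)
    exact integral_map (by fun_prop) (hF.comp (φ := fun q => p + q)
      (by fun_prop)).1.aestronglyMeasurable
  have hS : MeasurableSet {y : E | η ≤ ‖y‖} := measurableSet_le measurable_const measurable_norm
  rw [i1, i2, ← integral_sub ((hF1.integral_prod_right (μ d)).integrable _)
    ((hF2.integral_prod_right (μ d)).integrable _)]
  have hb : ∀ p : E × E, ‖∫ c, F (p + (c, c)) ∂(μ d) - ∫ c, F (p + (c, 0)) ∂(μ d)‖ ≤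
      ε + C * (μ d).real {y | η ≤ ‖y‖} := by
    intro p
    have j1 : Integrable (fun c => F (p + (c, c))) (μ d) :=
      (hF.comp (φ := fun c : E => p + (c, c)) (by fun_prop)).integrable _
    have j2 : Integrable (fun c => F (p + (c, 0))) (μ d) :=
      (hF.comp (φ := fun c : E => p + (c, 0)) (by fun_prop)).integrable _
    rw [← integral_sub j1 j2]
    have hint : Integrable (fun c : E => ε + {y : E | η ≤ ‖y‖}.indicator (fun _ => C) c) (μ d) :=
      (integrable_const ε).add ((integrable_const C).indicator hS)
    refine (norm_integral_le_of_norm_le hint (Eventually.of_forall fun c => ?_)).trans_eq ?_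
    · by_cases hc : c ∈ {y : E | η ≤ ‖y‖}
      · rw [indicator_of_mem hc, Real.norm_eq_abs, abs_le]
        have a1 := hF.pos (p + (c, c))
        have a2 := hF.pos (p + (c, 0))
        have a3 := hC (p + (c, c))
        have a4 := hC (p + (c, 0))
        constructor <;> linarith
      · rw [indicator_of_notMem hc, add_zero]
        refine hη _ _ ?_
        simp only [mem_ofPred_eq, not_le] at hc
        have hpos : 0 ≤ η := (norm_nonneg c).trans hc.le
        rw [dist_add_left, Prod.dist_eq, dist_self, dist_zero_right]
        exact max_lt ((norm_nonneg c).trans_lt hc) hc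
    · rw [integral_add (integrable_const ε) ((integrable_const C).indicator hS),
        integral_indicator_const _ hS]
      simp [mul_comm]
  simpa using norm_integral_le_of_norm_le_const (μ := pairLaw μ v w) (Eventually.of_forall hb)

lemma ConvolutionFamily.continuous_integral_pairLaw (hμ : ConvolutionFamily μ) {t : ℝ}
    (ht : 0 < t) {F : E × E → ℝ} (hF : BddPos F) (hFu : UniformContinuous F) :
    Continuous fun τ : unitInterval => ∫ p, F p ∂(pairLaw μ (τ * t) ((1 - τ) * t)) := by
  obtain ⟨c, C, hc, hcC⟩ := hF.2
  have hC0 : 0 < C := (hF.pos 0).trans_le (hcC 0).2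
  have key : ∀ ε > 0, ∃ ρ > 0, ∀ τ τ' : unitInterval, (τ : ℝ) ≤ τ' → (τ' : ℝ) - τ < ρ →
      |∫ p, F p ∂(pairLaw μ (τ' * t) ((1 - τ') * t)) -
        ∫ p, F p ∂(pairLaw μ (τ * t) ((1 - τ) * t))| < ε := by
    intro ε hε
    obtain ⟨η, hη, hmod⟩ := Metric.uniformContinuous_iff.1 hFu (ε / 2) (half_pos hε)
    have hsm := (hμ.small η hη).eventually (gt_mem_nhds (show 0 < ε / (2 * C) by positivity))
    obtain ⟨ρ, hρ, hρs⟩ := mem_nhdsGT_iff_exists_Ioo_subset.1 hsm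
    refine ⟨ρ / t, div_pos hρ ht, fun τ τ' hle hlt => ?_⟩
    rcases hle.eq_or_lt with heq | hlt'
    · rw [heq]; simpa using hε
    have hd : 0 < (τ' - τ : ℝ) * t := mul_pos (by linarith) ht
    have hdρ : (τ' - τ : ℝ) * t < ρ := by rwa [lt_div_iff₀ ht] at hlt
    have h1 := hμ.abs_integral_pairLaw_sub_le (v := τ * t) (w := (1 - τ') * t)
      (d := (τ' - τ) * t) (mul_nonneg τ.2.1 ht.le)
      (mul_nonneg (by linarith [τ'.2.2]) ht.le) hd.le hF (fun p => (hcC p).2) (half_pos hε).le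
      (fun p q hpq => (hmod hpq).le)
    have e1 : (τ : ℝ) * t + (τ' - τ) * t = τ' * t := by ring
    have e2 : (1 - τ' : ℝ) * t + (τ' - τ) * t = (1 - τ) * t := by ring
    rw [e1, e2] at h1
    refine h1.trans_lt ?_
    have h2 : (μ ((τ' - τ) * t)).real {y | η ≤ ‖y‖} < ε / (2 * C) := hρs ⟨hd, hdρ⟩
    have h3 := mul_lt_mul_of_pos_left h2 hC0
    have h4 : C * (ε / (2 * C)) = ε / 2 := by field_simp
    linarith
  refine Metric.continuous_iff.2 fun τ ε hε => ?_
  obtain ⟨ρ, hρ, h⟩ := key ε hε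
  refine ⟨ρ, hρ, fun τ' hd => ?_⟩
  rw [Subtype.dist_eq, Real.dist_eq, abs_lt] at hd
  rw [Real.dist_eq]
  rcases le_total (τ : ℝ) τ' with hle | hle
  · exact h τ τ' hle (by linarith)
  · rw [abs_sub_comm]; exact h τ' τ hle (by linarith)

lemma ConvolutionFamily.tendsto_integral_convPow (hμ : ConvolutionFamily μ) {t r : ℝ}
    (ht : 0 < t) (hr : 0 ≤ r) (hr1 : r ≤ 1) {F : E × E → ℝ} (hF : BddPos F)
    (hFu : UniformContinuous F) :
    Tendsto (fun n : ℕ => ∫ p, F p ∂(convPow (thinnedPair (μ (t / n)) r) n)) atTop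
      (𝓝 (∫ p, F p ∂(pairLaw μ (r * t) ((1 - r) * t)))) := by
  -- By the binomial expansion, the n-th integral is the n-th Bernstein polynomial of Φ at r.
  let Φ : C(unitInterval, ℝ) := ⟨_, hμ.continuous_integral_pairLaw ht hF hFu⟩
  let x : unitInterval := ⟨r, hr, hr1⟩
  have h1 : Tendsto (fun n => bernsteinApproximation n Φ x) atTop (𝓝 (Φ x)) :=
    ((continuous_eval_const x).tendsto Φ).comp (bernsteinApproximation_uniform Φ)
  refine h1.congr' ?_
  filter_upwards [eventually_gt_atTop 0] with n hn
  have hn' : (n : ℝ) ≠ 0 := by positivity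
  rw [hμ.integral_convPow (by positivity) hr hr1 hF, bernsteinApproximation.apply,
    ← Fin.sum_univ_eq_sum_range (fun i => (n.choose i : ℝ) * r ^ i * (1 - r) ^ (n - i) *
        ∫ p, F p ∂(pairLaw μ (i * (t / n)) ((n - i : ℕ) * (t / n)))) (n + 1)]
  refine Finset.sum_congr rfl fun i _ => ?_
  have hi : (i : ℕ) ≤ n := Nat.lt_succ_iff.1 i.2
  have e1 : ((i : ℕ) : ℝ) / n * t = (i : ℕ) * (t / n) := by ring
  have e2 : (1 - ((i : ℕ) : ℝ) / n) * t = (n - i : ℕ) * (t / n) := by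
    rw [Nat.cast_sub hi]; field_simp
  rw [bernstein_apply, smul_eq_mul]
  change _ * (∫ p, F p ∂(pairLaw μ (((i : ℕ) : ℝ) / n * t) ((1 - ((i : ℕ) : ℝ) / n) * t))) = _
  rw [e1, e2]

end PairLaw

lemma BddPos.uniformContinuous_rpow {X : Type*} [UniformSpace X] [MeasurableSpace X] {f : X → ℝ}
    (hf : BddPos f) (hu : UniformContinuous f) (a : ℝ) : UniformContinuous fun x => f x ^ a := by
  obtain ⟨c, C, hc, h⟩ := hf.2
  have h1 : UniformContinuousOn (fun y : ℝ => y ^ a) (Icc c C) :=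
    isCompact_Icc.uniformContinuousOn_of_continuous fun y hy =>
      (Real.continuousAt_rpow_const y a (Or.inl (hc.trans_le hy.1).ne')).continuousWithinAt
  rw [← uniformContinuousOn_univ] at hu ⊢
  exact h1.comp hu fun x _ => h x

lemma BddPos.uniformContinuous_mul {X : Type*} [UniformSpace X] [MeasurableSpace X] {f g : X → ℝ}
    (hf : BddPos f) (hg : BddPos g) (hfu : UniformContinuous f) (hgu : UniformContinuous g) :
    UniformContinuous fun x => f x * g x := by
  obtain ⟨c, C, hc, h⟩ := hf.2
  obtain ⟨c', C', hc', h'⟩ := hg.2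
  have h1 : UniformContinuousOn (fun y : ℝ × ℝ => y.1 * y.2) (Icc c C ×ˢ Icc c' C') :=
    (isCompact_Icc.prod isCompact_Icc).uniformContinuousOn_of_continuous
      continuous_mul.continuousOn
  have h2 : UniformContinuousOn (fun x => (f x, g x)) univ :=
    uniformContinuousOn_univ.2 (hfu.prodMk hgu)
  rw [← uniformContinuousOn_univ]
  exact h1.comp h2 fun x _ => ⟨h x, h' x⟩

/-! ### Passage to the limit and return to the semigroup -/

section Limit

variable {E : Type*} [NormedAddCommGroup E] [MeasurableSpace E] [BorelSpace E]
  [SecondCountableTopology E] {μ : ℝ → Measure E}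

/-- Reverse hypercontractivity of the small-time thinned pairs, up to constants `k n` with
`k n ^ n → K`. -/
def HasCellBound (μ : ℝ → Measure E) (t r a b K : ℝ) : Prop :=
  ∃ k : ℕ → ℝ, (∀ n, 0 ≤ k n) ∧ Tendsto (fun n => k n ^ n) atTop (𝓝 K) ∧
    ∀ᶠ n : ℕ in atTop, ReverseHC (thinnedPair (μ (t / n)) r) a b (k n)

lemma ConvolutionFamily.pairLaw_reverse_holder (hμ : ConvolutionFamily μ) {t r a b K : ℝ}
    (ht : 0 < t) (hr : 0 ≤ r) (hr1 : r ≤ 1) (ha : a ≠ 0) (hb : b ≠ 0)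
    (hk : HasCellBound μ t r a b K) {f h : E → ℝ} (hf : BddPos f) (hh : BddPos h)
    (hfu : UniformContinuous f) (hhu : UniformContinuous h) :
    (∫ p, f p.1 ^ a ∂(pairLaw μ (r * t) ((1 - r) * t))) ^ (1 / a) *
      (∫ p, h p.2 ^ (-b) ∂(pairLaw μ (r * t) ((1 - r) * t))) ^ (-(1 / b)) ≤
      K * ∫ p, f p.1 * h p.2 ∂(pairLaw μ (r * t) ((1 - r) * t)) := by
  obtain ⟨k, hk0, hkK, hk⟩ := hk
  have := hμ.prob_pairLaw (v := r * t) (w := (1 - r) * t) (by positivity)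
    (mul_nonneg (by linarith) ht.le)
  have b1 : BddPos fun p : E × E => f p.1 ^ a := (hf.rpow a).comp measurable_fst
  have b2 : BddPos fun p : E × E => h p.2 ^ (-b) := (hh.rpow (-b)).comp measurable_snd
  have b3 : BddPos fun p : E × E => f p.1 := hf.comp measurable_fst
  have b4 : BddPos fun p : E × E => h p.2 := hh.comp measurable_snd
  have u3 : UniformContinuous fun p : E × E => f p.1 := hfu.comp uniformContinuous_fst
  have u4 : UniformContinuous fun p : E × E => h p.2 := hhu.comp uniformContinuous_snd
  have t1 := hμ.tendsto_integral_convPow ht hr hr1 b1 (b3.uniformContinuous_rpow u3 a)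
  have t2 := hμ.tendsto_integral_convPow ht hr hr1 b2 (b4.uniformContinuous_rpow u4 (-b))
  have t3 := hμ.tendsto_integral_convPow ht hr hr1 (b3.mul b4) (b3.uniformContinuous_mul b4 u3 u4)
  refine le_of_tendsto_of_tendsto
    ((t1.rpow_const (p := 1 / a) (Or.inl (b1.integral_pos _).ne')).mul
      (t2.rpow_const (p := -(1 / b)) (Or.inl (b2.integral_pos _).ne'))) (hkK.mul t3) ?_
  filter_upwards [hk, eventually_gt_atTop 0] with n hn hn0
  have := hμ.prob (t / n) (by positivity)
  have := isProbabilityMeasure_thinnedPair (μ (t / n)) hr hr1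
  exact hn.convPow ha hb (hk0 n) n f h hf hh

/-- Equality case of reverse Hölder for the exponents q₂ and -q₂/(1-q₂): with g = L_{t-s} f and h =
g^(q₂-1), both integrals involving h equal G = ∫ g^q₂ dμ_s. The powers of G combine because 1 +
(1-q₂)/q₂ = 1/q₂. -/
lemma ConvolutionFamily.integral_rpow_le (hμ : ConvolutionFamily μ) {t s q₁ q₂ K : ℝ}
    (hs : 0 < s) (hst : s ≤ t) (hq₁ : 0 < q₁) (hq₂ : 0 < q₂) (hq₂1 : q₂ < 1)
    (hk : HasCellBound μ t (s / t) q₁ (q₂ / (1 - q₂)) K) {f : E → ℝ} (hf : BddPos f)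
    (hfu : UniformContinuous f) :
    (∫ y, f y ^ q₁ ∂(μ t)) ^ (1 / q₁) ≤
      K * (∫ y, (∫ z, f (y + z) ∂(μ (t - s))) ^ q₂ ∂(μ s)) ^ (1 / q₂) := by
  have ht : 0 < t := hs.trans_le hst
  have hw : 0 ≤ t - s := sub_nonneg.2 hst
  have := hμ.prob t ht.le
  have := hμ.prob s hs.le
  have := hμ.prob (t - s) hw
  set g : E → ℝ := fun y => ∫ z, f (y + z) ∂(μ (t - s)) with hg
  have bg : BddPos g := (hf.comp (φ := fun p : E × E => p.1 + p.2)
    (by fun_prop)).integral_prod_right _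
  have ug : UniformContinuous g := by
    rw [Metric.uniformContinuous_iff] at hfu ⊢
    intro ε hε
    obtain ⟨δ, hδ, h⟩ := hfu (ε / 2) (half_pos hε)
    refine ⟨δ, hδ, fun {x y} hxy => ?_⟩
    have i : ∀ x, Integrable (fun z => f (x + z)) (μ (t - s)) := fun x =>
      (hf.comp (φ := fun z : E => x + z) (by fun_prop)).integrable _
    rw [dist_eq_norm, hg, ← integral_sub (i x) (i y)]
    refine lt_of_le_of_lt ?_ (half_lt_self hε)
    refine (norm_integral_le_of_norm_le_const (C := ε / 2) (Eventually.of_forall fun z => ?_)).trans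
      (by simp)
    have := h (a := x + z) (b := y + z) (by rwa [dist_add_right])
    rw [dist_eq_norm] at this
    exact this.le
  have h1q : 0 < 1 - q₂ := by linarith
  have hr : 0 ≤ s / t := by positivity
  have hr1 : s / t ≤ 1 := (div_le_one ht).2 hst
  have main := hμ.pairLaw_reverse_holder ht hr hr1 hq₁.ne' (by positivity) hk hf (bg.rpow (q₂ - 1))
    hfu (bg.uniformContinuous_rpow ug _)
  have es : s / t * t = s := by field_simp
  have ew : (1 - s / t) * t = t - s := by field_simp
  rw [es, ew] at main
  have hmeas : AEMeasurable (fun p : E × E => (p.1 + p.2, p.1)) ((μ s).prod (μ (t - s))) :=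
    measurable_pairMap.aemeasurable
  have := hμ.prob_pairLaw hs.le hw
  have e1 : ∫ p, f p.1 ^ q₁ ∂(pairLaw μ s (t - s)) = ∫ y, f y ^ q₁ ∂(μ t) := by
    have hadd := hμ.add s (t - s) hs.le hw
    rw [add_sub_cancel] at hadd
    rw [pairLaw, integral_map hmeas ((hf.rpow q₁).comp measurable_fst).1.aestronglyMeasurable,
      hadd, Measure.conv, integral_map (by fun_prop) (hf.rpow q₁).1.aestronglyMeasurable]
  have e2 : ∫ p, (g p.2 ^ (q₂ - 1)) ^ (-(q₂ / (1 - q₂))) ∂(pairLaw μ s (t - s)) =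
      ∫ y, g y ^ q₂ ∂(μ s) := by
    have : ∀ y, (g y ^ (q₂ - 1)) ^ (-(q₂ / (1 - q₂))) = g y ^ q₂ := fun y => by
      rw [← Real.rpow_mul (bg.pos y).le]; congr 1; field_simp; ring
    simp only [this]
    rw [pairLaw, integral_map hmeas ((bg.rpow q₂).comp measurable_snd).1.aestronglyMeasurable]
    rw [integral_prod _ (((bg.rpow q₂).comp measurable_fst).integrable _)]
    simp
  -- Integrating out the increment after time s replaces f by g, and g · g^(q₂-1) = g^q₂.
  have e3 : ∫ p, f p.1 * g p.2 ^ (q₂ - 1) ∂(pairLaw μ s (t - s)) = ∫ y, g y ^ q₂ ∂(μ s) := by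
    have b : BddPos fun p : E × E => f p.1 * g p.2 ^ (q₂ - 1) :=
      (hf.comp measurable_fst).mul ((bg.rpow _).comp measurable_snd)
    rw [pairLaw, integral_map hmeas b.1.aestronglyMeasurable,
      integral_prod _ ((b.comp measurable_pairMap).integrable _)]
    refine integral_congr_ae (Eventually.of_forall fun y => ?_)
    simp only
    rw [integral_mul_const]
    change g y * _ = _
    conv_lhs => rw [← Real.rpow_one (g y), Real.rpow_one, mul_comm]
    rw [← Real.rpow_add_one (bg.pos y).ne', sub_add_cancel]
  rw [e1, e2, e3] at main
  have hG := (bg.rpow q₂).integral_pos (μ s)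
  set G := ∫ y, g y ^ q₂ ∂(μ s)
  have hpos : 0 < G ^ (1 / (q₂ / (1 - q₂))) := Real.rpow_pos_of_pos hG _
  rw [Real.rpow_neg hG.le, ← div_eq_mul_inv, div_le_iff₀ hpos] at main
  refine main.trans_eq ?_
  rw [mul_assoc]
  congr 1
  conv_lhs => rw [← Real.rpow_one G, ← Real.rpow_mul hG.le, ← Real.rpow_add hG]
  congr 1; field_simp; ring

end Limit

/-! ### Extension to Borel functions with values in [0, ∞] -/

section Extension

lemma lintegral_rpow_le_rpow_lintegral {α : Type*} [MeasurableSpace α] (μ : Measure α)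
    [IsProbabilityMeasure μ] {q : ℝ} (hq : 0 < q) (hq1 : q ≤ 1) {d : α → ℝ≥0∞}
    (hd : Measurable d) : ∫⁻ x, d x ^ q ∂μ ≤ (∫⁻ x, d x ∂μ) ^ q := by
  have h := eLpNorm'_le_eLpNorm'_of_exponent_le hq hq1 μ hd.aestronglyMeasurable
  simp only [eLpNorm', enorm_eq_self, ENNReal.rpow_one, one_div, inv_one] at h
  have h2 := ENNReal.rpow_le_rpow h hq.le
  rwa [← ENNReal.rpow_mul, inv_mul_cancel₀ hq.ne', ENNReal.rpow_one] at h2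

lemma ofReal_integral_rpow {α : Type*} [MeasurableSpace α] (μ : Measure α)
    [IsProbabilityMeasure μ] (q : ℝ) {f : α → ℝ} (hf : BddPos f) :
    ENNReal.ofReal (∫ x, f x ^ q ∂μ) = ∫⁻ x, ENNReal.ofReal (f x) ^ q ∂μ := by
  rw [ofReal_integral_eq_lintegral_ofReal ((hf.rpow q).integrable μ)
    (Eventually.of_forall fun x => ((hf.rpow q).pos x).le)]
  exact lintegral_congr fun x => (ENNReal.ofReal_rpow_of_pos (hf.pos x)).symm

variable {E : Type*} [NormedAddCommGroup E] [MeasurableSpace E] [BorelSpace E]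
  [ProperSpace E] {μ : ℝ → Measure E}

lemma ConvolutionFamily.lintegral_rpow_le_of_uniformContinuous (hμ : ConvolutionFamily μ)
    {t s q₁ q₂ K : ℝ} (hs : 0 < s) (hst : s ≤ t) (hq₁ : 0 < q₁) (hq₂ : 0 < q₂) (hq₂1 : q₂ < 1)
    (hK : 0 ≤ K) (hk : HasCellBound μ t (s / t) q₁ (q₂ / (1 - q₂)) K) {f : E → ℝ}
    (hf : BddPos f) (hfu : UniformContinuous f) :
    (∫⁻ y, ENNReal.ofReal (f y) ^ q₁ ∂(μ t)) ^ (1 / q₁) ≤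
      ENNReal.ofReal K *
        (∫⁻ y, (∫⁻ z, ENNReal.ofReal (f (y + z)) ∂(μ (t - s))) ^ q₂ ∂(μ s)) ^ (1 / q₂) := by
  have := hμ.prob t (hs.le.trans hst)
  have := hμ.prob s hs.le
  have := hμ.prob (t - s) (sub_nonneg.2 hst)
  have bg : BddPos fun y : E => ∫ z, f (y + z) ∂(μ (t - s)) :=
    (hf.comp (φ := fun p : E × E => p.1 + p.2) (by fun_prop)).integral_prod_right _
  have e : ∀ y, ENNReal.ofReal (∫ z, f (y + z) ∂(μ (t - s))) =
      ∫⁻ z, ENNReal.ofReal (f (y + z)) ∂(μ (t - s)) := fun y =>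
    ofReal_integral_eq_lintegral_ofReal
      ((hf.comp (φ := fun z : E => y + z) (by fun_prop)).integrable _)
      (Eventually.of_forall fun z => (hf.pos _).le)
  simp only [← e]
  rw [← ofReal_integral_rpow _ _ hf, ← ofReal_integral_rpow _ _ bg,
    ENNReal.ofReal_rpow_of_pos ((hf.rpow _).integral_pos _),
    ENNReal.ofReal_rpow_of_pos ((bg.rpow _).integral_pos _), ← ENNReal.ofReal_mul hK]
  exact ENNReal.ofReal_le_ofReal (hμ.integral_rpow_le hs hst hq₁ hq₂ hq₂1 hk hf hfu)

/-- A bounded measurable function is close in `L¹` to a uniformly continuous one. -/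
lemma exists_uniformContinuous_lintegral_sub_le (ρ : Measure E) [IsProbabilityMeasure ρ]
    {f : E → ℝ≥0∞} (hf : Measurable f) {M : ℝ} (hM : ∀ x, f x ≤ ENNReal.ofReal M) {ε : ℝ}
    (hε : 0 < ε) :
    ∃ g : E → ℝ, BddPos g ∧ UniformContinuous g ∧ ∃ d : E → ℝ≥0∞, Measurable d ∧
      (∀ x, f x ≤ ENNReal.ofReal (g x) + d x) ∧ (∀ x, ENNReal.ofReal (g x) ≤ f x + d x) ∧
      ∫⁻ x, d x ∂ρ ≤ ENNReal.ofReal (2 * ε) := by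
  have hft : ∀ x, f x ≠ ⊤ := fun x => ((hM x).trans_lt ENNReal.ofReal_lt_top).ne
  have hfi : Integrable (fun x => (f x).toReal) ρ := by
    refine Integrable.of_bound hf.ennreal_toReal.aestronglyMeasurable (max M 0)
      (Eventually.of_forall fun x => ?_)
    rw [Real.norm_of_nonneg ENNReal.toReal_nonneg]
    refine ENNReal.toReal_le_of_le_ofReal (le_max_right _ _) ((hM x).trans ?_)
    exact ENNReal.ofReal_le_ofReal (le_max_left _ _)
  obtain ⟨F, hFs, hFd, hFc, -⟩ := hfi.exists_hasCompactSupport_lintegral_sub_le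
    (ε := ENNReal.ofReal ε) (by simpa using hε)
  obtain ⟨C, hC⟩ := hFc.bounded_above_of_compact_support hFs
  have hu : UniformContinuous F := hFc.uniformContinuous_of_tendsto_cocompact
    (x := 0) hFs.is_zero_at_infty
  -- Truncating below at ε keeps g away from zero; the extra ε in d pays for it.
  refine ⟨fun x => max (F x) ε, ⟨by fun_prop, ε, max C ε, hε, fun x => ⟨le_max_right _ _, ?_⟩⟩,
    ?_, fun x => ‖(f x).toReal - F x‖ₑ + ENNReal.ofReal ε, ?_, ?_, ?_, ?_⟩
  · exact max_le_max ((le_abs_self _).trans (hC x)) le_rfl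
  · exact ((LipschitzWith.id.max_const ε).uniformContinuous).comp hu
  · fun_prop
  · intro x
    dsimp only
    rw [← ofReal_norm, ← ENNReal.ofReal_add (norm_nonneg _) hε.le,
      ← ENNReal.ofReal_add (hε.le.trans (le_max_right _ _)) (by positivity),
      ← ENNReal.ofReal_toReal (hft x)]
    refine ENNReal.ofReal_le_ofReal ?_
    rw [ENNReal.toReal_ofReal ENNReal.toReal_nonneg, Real.norm_eq_abs]
    have := le_abs_self ((f x).toReal - F x)
    have := le_max_left (F x) ε
    linarith
  · intro x
    dsimp only
    rw [← ofReal_norm, ← ENNReal.ofReal_add (norm_nonneg _) hε.le]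
    conv_rhs => rw [← ENNReal.ofReal_toReal (hft x)]
    rw [← ENNReal.ofReal_add ENNReal.toReal_nonneg (by positivity),
      ENNReal.toReal_ofReal ENNReal.toReal_nonneg]
    refine ENNReal.ofReal_le_ofReal (max_le ?_ ?_)
    · have := neg_abs_le ((f x).toReal - F x)
      rw [Real.norm_eq_abs]
      linarith
    · have := ENNReal.toReal_nonneg (a := f x)
      have := norm_nonneg ((f x).toReal - F x)
      linarith
  · rw [lintegral_add_right _ measurable_const, lintegral_const, measure_univ, mul_one, two_mul,
      ENNReal.ofReal_add hε.le hε.le]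
    gcongr

/-- Approximation in L¹(μ_t) controls both sides: x ↦ x^q is subadditive for 0 < q ≤ 1, Jensen
bounds the integral of d^q, and the error on the right averages back to μ_t because μ_t is the
convolution of μ_s and μ_{t-s}. -/
lemma ConvolutionFamily.lintegral_rpow_le_of_bounded (hμ : ConvolutionFamily μ)
    {t s q₁ q₂ K : ℝ} (hs : 0 < s) (hst : s ≤ t) (hq₁ : 0 < q₁) (hq₁1 : q₁ < 1) (hq₂ : 0 < q₂)
    (hq₂1 : q₂ < 1) (hK : 0 ≤ K) (hk : HasCellBound μ t (s / t) q₁ (q₂ / (1 - q₂)) K)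
    {f : E → ℝ≥0∞} (hf : Measurable f) {M : ℝ} (hM : ∀ x, f x ≤ ENNReal.ofReal M) :
    (∫⁻ y, f y ^ q₁ ∂(μ t)) ^ (1 / q₁) ≤
      ENNReal.ofReal K *
        (∫⁻ y, (∫⁻ z, f (y + z) ∂(μ (t - s))) ^ q₂ ∂(μ s)) ^ (1 / q₂) := by
  have hw : 0 ≤ t - s := sub_nonneg.2 hst
  have := hμ.prob t (hs.le.trans hst)
  have := hμ.prob s hs.le
  have := hμ.prob (t - s) hw
  set A := ∫⁻ y, f y ^ q₁ ∂(μ t)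
  set B := ∫⁻ y, (∫⁻ z, f (y + z) ∂(μ (t - s))) ^ q₂ ∂(μ s)
  have step : ∀ ε : ℝ, 0 < ε → A ≤ (ENNReal.ofReal K *
      (B + ENNReal.ofReal (2 * ε) ^ q₂) ^ (1 / q₂)) ^ q₁ + ENNReal.ofReal (2 * ε) ^ q₁ := by
    intro ε hε
    obtain ⟨g, bg, ug, d, hd, h1, h2, h3⟩ :=
      exists_uniformContinuous_lintegral_sub_le (μ t) hf hM hε
    have hgm := bg.1
    have main := hμ.lintegral_rpow_le_of_uniformContinuous hs hst hq₁ hq₂ hq₂1 hK hk bg ug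
    have a1 : A ≤ ∫⁻ y, ENNReal.ofReal (g y) ^ q₁ ∂(μ t) + ENNReal.ofReal (2 * ε) ^ q₁ := by
      calc A ≤ ∫⁻ y, (ENNReal.ofReal (g y) ^ q₁ + d y ^ q₁) ∂(μ t) :=
            lintegral_mono fun y => (ENNReal.rpow_le_rpow (h1 y) hq₁.le).trans
              (ENNReal.rpow_add_le_add_rpow _ _ hq₁.le hq₁1.le)
        _ = ∫⁻ y, ENNReal.ofReal (g y) ^ q₁ ∂(μ t) + ∫⁻ y, d y ^ q₁ ∂(μ t) :=
            lintegral_add_right _ (by fun_prop)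
        _ ≤ _ := by
            gcongr
            exact (lintegral_rpow_le_rpow_lintegral _ hq₁ hq₁1.le hd).trans
              (ENNReal.rpow_le_rpow h3 hq₁.le)
    have hadd := hμ.add s (t - s) hs.le hw
    rw [add_sub_cancel] at hadd
    have hdd : ∫⁻ y, ∫⁻ z, d (y + z) ∂(μ (t - s)) ∂(μ s) = ∫⁻ x, d x ∂(μ t) := by
      rw [hadd, Measure.lintegral_conv hd]
    have mD : Measurable fun y => ∫⁻ z, d (y + z) ∂(μ (t - s)) :=
      Measurable.lintegral_prod_right' (f := fun p : E × E => d (p.1 + p.2)) (by fun_prop)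
    have a2 : ∫⁻ y, (∫⁻ z, ENNReal.ofReal (g (y + z)) ∂(μ (t - s))) ^ q₂ ∂(μ s) ≤
        B + ENNReal.ofReal (2 * ε) ^ q₂ := by
      calc _ ≤ ∫⁻ y, ((∫⁻ z, f (y + z) ∂(μ (t - s))) ^ q₂ +
              (∫⁻ z, d (y + z) ∂(μ (t - s))) ^ q₂) ∂(μ s) := by
            refine lintegral_mono fun y => ?_
            refine le_trans ?_ (ENNReal.rpow_add_le_add_rpow _ _ hq₂.le hq₂1.le)
            refine ENNReal.rpow_le_rpow ?_ hq₂.le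
            rw [← lintegral_add_right _ (by fun_prop)]
            exact lintegral_mono fun z => h2 _
        _ = B + ∫⁻ y, (∫⁻ z, d (y + z) ∂(μ (t - s))) ^ q₂ ∂(μ s) :=
            lintegral_add_right _ (mD.pow_const q₂)
        _ ≤ _ := by
            gcongr
            refine (lintegral_rpow_le_rpow_lintegral _ hq₂ hq₂1.le mD).trans ?_
            rw [hdd]
            exact ENNReal.rpow_le_rpow h3 hq₂.le
    refine a1.trans (add_le_add_left ?_ _)
    have := ENNReal.rpow_le_rpow main hq₁.le
    rw [← ENNReal.rpow_mul, one_div_mul_cancel hq₁.ne', ENNReal.rpow_one] at this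
    refine this.trans ?_
    gcongr
  have lim0 : Tendsto (fun n : ℕ => ENNReal.ofReal (2 * (1 / ((n : ℝ) + 1)))) atTop (𝓝 0) := by
    have := (tendsto_one_div_add_atTop_nhds_zero_nat (𝕜 := ℝ)).const_mul 2
    simpa using ENNReal.tendsto_ofReal this
  have limq : ∀ q : ℝ, 0 < q →
      Tendsto (fun n : ℕ => ENNReal.ofReal (2 * (1 / ((n : ℝ) + 1))) ^ q) atTop (𝓝 0) := by
    intro q hq
    have := lim0.ennrpow_const q
    rwa [ENNReal.zero_rpow_of_pos hq] at this
  have lim : Tendsto (fun n : ℕ => (ENNReal.ofReal K *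
      (B + ENNReal.ofReal (2 * (1 / ((n : ℝ) + 1))) ^ q₂) ^ (1 / q₂)) ^ q₁ +
        ENNReal.ofReal (2 * (1 / ((n : ℝ) + 1))) ^ q₁) atTop
      (𝓝 ((ENNReal.ofReal K * B ^ (1 / q₂)) ^ q₁)) := by
    have h1 := (tendsto_const_nhds (x := B)).add (limq q₂ hq₂)
    have h2 := (ENNReal.Tendsto.const_mul (a := ENNReal.ofReal K) (h1.ennrpow_const (1 / q₂))
      (Or.inr ENNReal.ofReal_ne_top)).ennrpow_const q₁
    simpa using h2.add (limq q₁ hq₁)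
  have hfin : A ≤ (ENNReal.ofReal K * B ^ (1 / q₂)) ^ q₁ :=
    ge_of_tendsto' lim fun n => step _ (by positivity)
  have := ENNReal.rpow_le_rpow hfin (one_div_pos.2 hq₁).le
  rwa [← ENNReal.rpow_mul, mul_one_div_cancel hq₁.ne', ENNReal.rpow_one] at this

/-- Monotone convergence along the truncations min(f, n); only the left side needs a limit, the
right side being monotone in f. -/
theorem ConvolutionFamily.lintegral_rpow_le (hμ : ConvolutionFamily μ)
    {t s q₁ q₂ K : ℝ} (hs : 0 < s) (hst : s ≤ t) (hq₁ : 0 < q₁) (hq₁1 : q₁ < 1) (hq₂ : 0 < q₂)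
    (hq₂1 : q₂ < 1) (hK : 0 ≤ K) (hk : HasCellBound μ t (s / t) q₁ (q₂ / (1 - q₂)) K)
    {f : E → ℝ≥0∞} (hf : Measurable f) :
    (∫⁻ y, f y ^ q₁ ∂(μ t)) ^ (1 / q₁) ≤
      ENNReal.ofReal K *
        (∫⁻ y, (∫⁻ z, f (y + z) ∂(μ (t - s))) ^ q₂ ∂(μ s)) ^ (1 / q₂) := by
  have htend : Tendsto (fun n : ℕ => ∫⁻ y, (min (f y) n) ^ q₁ ∂(μ t)) atTop
      (𝓝 (∫⁻ y, f y ^ q₁ ∂(μ t))) := by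
    refine lintegral_tendsto_of_tendsto_of_monotone (fun n => by fun_prop)
      (Eventually.of_forall fun y m n hmn => ?_) (Eventually.of_forall fun y => ?_)
    · dsimp only
      gcongr
    · refine Tendsto.ennrpow_const q₁ ?_
      have := (tendsto_const_nhds (x := f y)).min ENNReal.tendsto_nat_nhds_top
      simpa using this
  refine le_of_tendsto' (htend.ennrpow_const (1 / q₁)) fun n => ?_
  refine (hμ.lintegral_rpow_le_of_bounded hs hst hq₁ hq₁1 hq₂ hq₂1 hK hk
    (f := fun y => min (f y) n) (by fun_prop) (M := n) (fun x => ?_)).trans ?_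
  · rw [ENNReal.ofReal_natCast]; exact min_le_right _ _
  · gcongr
    exact min_le_left _ _

end Extension

/-! ### Small-time estimates from the generator, and the atom of μ_t for finite ν -/

lemma exists_pos_mul_le {A κ : ℝ} (hA : 0 ≤ A) (hκ : 0 < κ) :
    ∃ θ > 0, θ ≤ 1 ∧ θ * A ≤ κ := by
  refine ⟨min 1 (κ / (A + 1)), by positivity, min_le_left _ _, ?_⟩
  calc _ ≤ κ / (A + 1) * (A + 1) :=
        mul_le_mul (min_le_right _ _) (by linarith) hA (by positivity)
    _ = κ := by field_simp

lemma tendsto_mul_const_nhdsGT_zero (A : ℝ) :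
    Tendsto (fun δ : ℝ => δ * A) (𝓝[>] 0) (𝓝 0) := by
  have h : Continuous fun δ : ℝ => δ * A := by fun_prop
  simpa using (h.tendsto 0).mono_left nhdsWithin_le_nhds

section Taylor

variable {E : Type*} [NormedAddCommGroup E] [NormedSpace ℝ E]

lemma ContDiff.exists_abs_taylor_le {φ : E → ℝ} (hφ : ContDiff ℝ ∞ φ) (hs : HasCompactSupport φ) :
    ∃ M : ℝ, 0 ≤ M ∧ ∀ x y, |φ (x + y) - φ x - fderiv ℝ φ x y| ≤ M * ‖y‖ ^ 2 := by
  have h1 : ContDiff ℝ 1 (fderiv ℝ φ) :=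
    (contDiff_infty.1 hφ 2).fderiv_right (by norm_num)
  obtain ⟨K, hK⟩ := h1.lipschitzWith_of_hasCompactSupport (hs.fderiv ℝ) one_ne_zero
  refine ⟨K, K.2, fun x y => ?_⟩
  have := (convex_closedBall x ‖y‖).norm_image_sub_le_of_norm_fderiv_le' (𝕜 := ℝ) (f := φ)
    (φ := fderiv ℝ φ x) (C := K * ‖y‖) (x := x) (y := x + y)
    (fun z _ => (hφ.differentiable (by simp)) z) (fun z hz => ?_)
    (Metric.mem_closedBall_self (norm_nonneg _)) (by simp)
  · rw [add_sub_cancel_left, Real.norm_eq_abs] at this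
    exact this.trans_eq (by ring)
  · rw [← dist_eq_norm]
    exact (hK.dist_le_mul z x).trans (by gcongr; exact hz)

lemma ContDiff.exists_norm_fderiv_le {φ : E → ℝ} (hφ : ContDiff ℝ ∞ φ)
    (hs : HasCompactSupport φ) : ∃ L : ℝ, 0 ≤ L ∧ ∀ x, ‖fderiv ℝ φ x‖ ≤ L := by
  obtain ⟨L, hL⟩ := (hφ.continuous_fderiv (by simp)).bounded_above_of_compact_support (hs.fderiv ℝ)
  exact ⟨L, (norm_nonneg _).trans (hL 0), hL⟩

end Taylor

section Atom

variable {E : Type*} [NormedAddCommGroup E] [InnerProductSpace ℝ E] [FiniteDimensional ℝ E]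
  [MeasurableSpace E] [BorelSpace E] {ν : Measure E} {μ : ℝ → Measure E}

/-- The drift `-∫ z / (1 + |z|²) dν(z)` of the compound Poisson process with jump measure `ν`. -/
noncomputable def levyDrift (ν : Measure E) : E := -∫ z, (1 / (1 + ‖z‖ ^ 2)) • z ∂ν

lemma integrable_smul_compensator (ν : Measure E) [IsFiniteMeasure ν] :
    Integrable (fun z : E => (1 / (1 + ‖z‖ ^ 2)) • z) ν := by
  refine Integrable.of_bound (Measurable.aestronglyMeasurable (by fun_prop)) 1
    (Eventually.of_forall fun z => ?_)
  rw [norm_smul, Real.norm_of_nonneg (by positivity), one_div_mul_eq_div,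
    div_le_one (by positivity)]
  nlinarith [sq_nonneg (‖z‖ - 1)]

variable {χ : ContDiffBump (0 : E)}

omit [MeasurableSpace E] [BorelSpace E] in
lemma ContDiffBump.norm_le_rOut_of_ne_zero {z : E} (h : χ z ≠ 0) : ‖z‖ ≤ χ.rOut := by
  by_contra hlt
  exact h (χ.zero_of_le_dist (by rw [dist_zero_right]; exact (not_le.1 hlt).le))

omit [MeasurableSpace E] [BorelSpace E] in
lemma ContDiffBump.norm_smul_self_le (z : E) : ‖χ z • z‖ ≤ χ.rOut := by
  rcases eq_or_ne (χ z) 0 with h | h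
  · rw [h, zero_smul, norm_zero]; exact χ.rOut_pos.le
  · rw [norm_smul, Real.norm_of_nonneg χ.nonneg]
    exact (mul_le_of_le_one_left (norm_nonneg z) χ.le_one).trans (norm_le_rOut_of_ne_zero h)

omit [MeasurableSpace E] [BorelSpace E] in
lemma ContDiffBump.mul_norm_sq_le (z : E) : χ z * ‖z‖ ^ 2 ≤ χ.rOut ^ 2 := by
  rcases eq_or_ne (χ z) 0 with h | h
  · rw [h, zero_mul]; positivity
  · exact (mul_le_of_le_one_left (sq_nonneg _) χ.le_one).trans
      (pow_le_pow_left₀ (norm_nonneg z) (norm_le_rOut_of_ne_zero h) 2)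

lemma ContDiffBump.integrable_of_isFiniteMeasure (ρ : Measure E) [IsFiniteMeasure ρ] : Integrable χ ρ :=
  Integrable.of_bound χ.continuous.aestronglyMeasurable 1 (Eventually.of_forall fun z => by
    rw [Real.norm_of_nonneg χ.nonneg]; exact χ.le_one)

lemma ContDiffBump.integrable_smul_self (ρ : Measure E) [IsFiniteMeasure ρ] :
    Integrable (fun z => χ z • z) ρ :=
  Integrable.of_bound (χ.continuous.smul continuous_id).aestronglyMeasurable χ.rOut
    (Eventually.of_forall ContDiffBump.norm_smul_self_le)

lemma ContDiffBump.integrable_mul_norm_sq (ρ : Measure E) [IsFiniteMeasure ρ] :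
    Integrable (fun z => χ z * ‖z‖ ^ 2) ρ :=
  Integrable.of_bound (χ.continuous.mul (by fun_prop)).aestronglyMeasurable (χ.rOut ^ 2)
    (Eventually.of_forall fun z => by
      rw [Real.norm_of_nonneg (mul_nonneg χ.nonneg (sq_nonneg _))]
      exact ContDiffBump.mul_norm_sq_le z)

omit [BorelSpace E] in
/-- Small-time mass of the semigroup near the origin. -/
lemma IsPureJumpLevySemigroup.eventually_integral_bump (hμ : IsPureJumpLevySemigroup ν μ)
    [IsFiniteMeasure ν] (χ : ContDiffBump (0 : E)) {κ : ℝ} (hκ : 0 < κ) :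
    ∀ᶠ δ in 𝓝[>] (0 : ℝ), 1 - δ * (ν.real univ + κ) ≤ ∫ y, χ y ∂(μ δ) := by
  have hg := hμ.generator χ χ.contDiff χ.hasCompactSupport 0
  have h1 : χ 0 = 1 := χ.one_of_mem_closedBall (Metric.mem_closedBall_self χ.rIn_pos.le)
  have hd : fderiv ℝ χ 0 = 0 := by
    rw [(χ.eventuallyEq_one).fderiv_eq]; exact fderiv_const_apply 1
  have hI : -ν.real univ ≤ levyOperator ν χ 0 := by
    have : ‖levyOperator ν χ 0‖ ≤ 1 * ν.real univ := by
      refine norm_integral_le_of_norm_le_const (Eventually.of_forall fun z => ?_)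
      rw [hd, h1, zero_add]
      have a := χ.nonneg (x := z)
      have b := χ.le_one (x := z)
      simp only [zero_apply, zero_mul, sub_zero, Real.norm_eq_abs, abs_le]
      constructor <;> linarith
    have := (abs_le.1 (Real.norm_eq_abs _ ▸ this)).1
    linarith
  have hev := hg.eventually (lt_mem_nhds (show -ν.real univ - κ < levyOperator ν χ 0 by linarith))
  filter_upwards [hev, self_mem_nhdsWithin] with δ h hδ
  simp only [zero_add, h1] at h
  rw [lt_div_iff₀ hδ] at h
  linarith

omit [BorelSpace E] in
/-- Small-time truncated second moment of the semigroup. -/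
lemma IsPureJumpLevySemigroup.eventually_integral_norm_sq (hμ : IsPureJumpLevySemigroup ν μ)
    [IsFiniteMeasure ν] (χ : ContDiffBump (0 : E)) {κ : ℝ} (hκ : 0 < κ) :
    ∀ᶠ δ in 𝓝[>] (0 : ℝ),
      ∫ y, χ y * ‖y‖ ^ 2 ∂(μ δ) ≤ δ * (χ.rOut ^ 2 * ν.real univ + κ) := by
  have hsm : ContDiff ℝ ∞ fun y : E => χ y * ‖y‖ ^ 2 := χ.contDiff.mul (contDiff_norm_sq ℝ)
  have hg := hμ.generator _ hsm χ.hasCompactSupport.mul_right 0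
  have hd : fderiv ℝ (fun y : E => χ y * ‖y‖ ^ 2) 0 = 0 := by
    have : (fun y : E => χ y * ‖y‖ ^ 2) =ᶠ[𝓝 0] fun y => ‖y‖ ^ 2 := by
      filter_upwards [χ.eventuallyEq_one] with y hy
      rw [hy]; simp
    rw [this.fderiv_eq, fderiv_norm_sq_apply]
    simp
  have hI : levyOperator ν (fun y : E => χ y * ‖y‖ ^ 2) 0 ≤ χ.rOut ^ 2 * ν.real univ := by
    refine (le_abs_self _).trans ?_
    rw [← Real.norm_eq_abs]
    refine norm_integral_le_of_norm_le_const (Eventually.of_forall fun z => ?_)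
    rw [hd]
    simp only [zero_add, norm_zero, ne_eq, OfNat.ofNat_ne_zero, not_false_eq_true, zero_pow,
      mul_zero, sub_zero, zero_apply, zero_mul]
    rw [Real.norm_of_nonneg (mul_nonneg χ.nonneg (sq_nonneg _))]
    exact ContDiffBump.mul_norm_sq_le z
  have hev := hg.eventually (gt_mem_nhds (lt_of_le_of_lt hI (lt_add_of_pos_right _ hκ)))
  filter_upwards [hev, self_mem_nhdsWithin] with δ h hδ
  simp only [zero_add, norm_zero, ne_eq, OfNat.ofNat_ne_zero, not_false_eq_true, zero_pow,
      mul_zero, sub_zero] at h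
  rw [div_lt_iff₀ hδ] at h
  linarith

/-- Small-time truncated first moment of the semigroup. -/
lemma IsPureJumpLevySemigroup.eventually_integral_smul (hμ : IsPureJumpLevySemigroup ν μ)
    [IsFiniteMeasure ν] (χ : ContDiffBump (0 : E)) {κ : ℝ} (hκ : 0 < κ) :
    ∀ᶠ δ in 𝓝[>] (0 : ℝ), ‖(∫ y, χ y • y ∂(μ δ)) - δ • levyDrift ν‖ ≤
      δ * (χ.rOut * ν.real univ + κ) := by
  -- d is the derivative at δ = 0 of the truncated first moment. It differs from the drift by the
  -- integral of χ(z) z against ν.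
  set d : E := ∫ z, (χ z • z - (1 / (1 + ‖z‖ ^ 2)) • z) ∂ν with hd
  have hint : Integrable (fun z : E => χ z • z - (1 / (1 + ‖z‖ ^ 2)) • z) ν :=
    (ContDiffBump.integrable_smul_self ν).sub (integrable_smul_compensator ν)
  have hdb : ‖d - levyDrift ν‖ ≤ χ.rOut * ν.real univ := by
    rw [hd, integral_sub (ContDiffBump.integrable_smul_self ν) (integrable_smul_compensator ν),
      levyDrift, sub_neg_eq_add, sub_add_cancel]
    exact norm_integral_le_of_norm_le_const (Eventually.of_forall ContDiffBump.norm_smul_self_le)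
  have hlim : ∀ e : E, Tendsto (fun δ : ℝ => inner ℝ e (δ⁻¹ • ∫ y, χ y • y ∂(μ δ))) (𝓝[>] 0)
      (𝓝 (inner ℝ e d)) := by
    intro e
    have hsm : ContDiff ℝ ∞ fun y : E => χ y * inner ℝ e y :=
      χ.contDiff.mul (contDiff_const.inner ℝ contDiff_id)
    have hg := hμ.generator _ hsm χ.hasCompactSupport.mul_right 0
    have hf : fderiv ℝ (fun y : E => χ y * inner ℝ e y) 0 = innerSL ℝ e := by
      have : (fun y : E => χ y * inner ℝ e y) =ᶠ[𝓝 0] fun y => innerSL ℝ e y := by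
        filter_upwards [χ.eventuallyEq_one] with y hy
        rw [hy]; simp
      rw [this.fderiv_eq]
      exact (innerSL ℝ e).fderiv
    have hI : levyOperator ν (fun y : E => χ y * inner ℝ e y) 0 = inner ℝ e d := by
      rw [hd, ← integral_inner hint, levyOperator, hf]
      refine integral_congr_ae (Eventually.of_forall fun z => ?_)
      simp only [zero_add, inner_zero_right, mul_zero, sub_zero, innerSL_apply_apply,
        inner_sub_right, inner_smul_right]
      ring
    rw [hI] at hg
    refine hg.congr' ?_
    filter_upwards [self_mem_nhdsWithin] with δ hδ
    have := hμ.isProbabilityMeasure δ (le_of_lt hδ)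
    rw [inner_smul_right, ← integral_inner (ContDiffBump.integrable_smul_self (μ δ))]
    simp only [zero_add, inner_zero_right, mul_zero, sub_zero, inner_smul_right]
    rw [div_eq_inv_mul]
  -- The generator acts on scalar test functions, so the vector limit is reassembled from
  -- coordinates in an orthonormal basis.
  have hvec : Tendsto (fun δ : ℝ => δ⁻¹ • ∫ y, χ y • y ∂(μ δ)) (𝓝[>] 0) (𝓝 d) := by
    have := tendsto_finsetSum Finset.univ fun i _ =>
      (hlim (stdOrthonormalBasis ℝ E i)).smul_const (stdOrthonormalBasis ℝ E i)
    simpa only [OrthonormalBasis.sum_repr'] using this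
  filter_upwards [Metric.tendsto_nhds.1 hvec κ hκ, self_mem_nhdsWithin] with δ h hδ
  have hδ0 : (0 : ℝ) < δ := hδ
  rw [dist_eq_norm] at h
  have e : (∫ y, χ y • y ∂(μ δ)) - δ • levyDrift ν =
      δ • ((δ⁻¹ • ∫ y, χ y • y ∂(μ δ)) - d + (d - levyDrift ν)) := by
    rw [sub_add_sub_cancel, smul_sub, smul_inv_smul₀ hδ0.ne']
  rw [e, norm_smul, Real.norm_of_nonneg hδ0.le]
  gcongr
  refine (norm_add_le _ _).trans ?_
  linarith

/-- The no-jump contribution to L_δ φ, uniformly in x. The generator hypothesis is only pointwise,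
so it is used at 0 on cut-off versions of 1, y and ‖y‖², and Taylor's formula transfers the result
to every x. -/
lemma IsPureJumpLevySemigroup.eventually_le_integral (hμ : IsPureJumpLevySemigroup ν μ)
    [IsFiniteMeasure ν] {φ : E → ℝ} (hφ : ContDiff ℝ ∞ φ) (hs : HasCompactSupport φ)
    (h0 : ∀ x, 0 ≤ φ x) {κ : ℝ} (hκ : 0 < κ) :
    ∀ᶠ δ in 𝓝[>] (0 : ℝ), ∀ x,
      (1 - δ * ν.real univ) * φ (x + δ • levyDrift ν) - κ * δ ≤ ∫ y, φ (x + y) ∂(μ δ) := by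
  obtain ⟨M, hM, hT⟩ := hφ.exists_abs_taylor_le hs
  obtain ⟨L, hL, hLip⟩ := hφ.exists_norm_fderiv_le hs
  obtain ⟨S, hS⟩ := hφ.continuous.bounded_above_of_compact_support hs
  have hS0 : 0 ≤ S := (norm_nonneg _).trans (hS 0)
  set C := ν.real univ
  have hC0 : 0 ≤ C := measureReal_nonneg
  set b := levyDrift ν
  have hκ4 : 0 < κ / 4 := by positivity
  -- η, the cut-off radius, absorbs the contribution of small jumps to the first and second moments;
  -- θ absorbs the errors in the small-time limits. Each costs at most κδ/4, as do the terms of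
  -- order δ².
  obtain ⟨η, hη, hη1, hηκ⟩ := exists_pos_mul_le (show 0 ≤ L * C + M * C by positivity) hκ4
  obtain ⟨θ, hθ, -, hθκ⟩ := exists_pos_mul_le (show 0 ≤ S + L + M by positivity) hκ4
  let χ : ContDiffBump (0 : E) := ⟨η / 2, η, half_pos hη, half_lt_self hη⟩
  have hχη : χ.rOut = η := rfl
  have hsmall := (tendsto_mul_const_nhdsGT_zero (C * L * ‖b‖ + M * ‖b‖ ^ 2)).eventually
    (gt_mem_nhds hκ4)
  have hsmall' := (tendsto_mul_const_nhdsGT_zero C).eventually (gt_mem_nhds one_pos)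
  filter_upwards [hμ.eventually_integral_bump χ hθ, hμ.eventually_integral_norm_sq χ hθ,
    hμ.eventually_integral_smul χ hθ, hsmall, hsmall', self_mem_nhdsWithin]
    with δ g1 g2 g3 g4 g5 hδ x
  have hδ0 : (0 : ℝ) < δ := hδ
  have := hμ.isProbabilityMeasure δ hδ0.le
  rw [hχη] at g2 g3
  set ℓ := fderiv ℝ φ x
  have i1 : Integrable (fun y => φ x * χ y) (μ δ) := (ContDiffBump.integrable_of_isFiniteMeasure _).const_mul _
  have i2 : Integrable (fun y => ℓ (χ y • y)) (μ δ) :=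
    ℓ.integrable_comp (ContDiffBump.integrable_smul_self _)
  have i3 : Integrable (fun y => M * (χ y * ‖y‖ ^ 2)) (μ δ) :=
    (ContDiffBump.integrable_mul_norm_sq _).const_mul _
  have i4 : Integrable (fun y => φ (x + y)) (μ δ) :=
    Integrable.of_bound (hφ.continuous.comp (by fun_prop)).aestronglyMeasurable S
      (Eventually.of_forall fun y => hS _)
  -- As φ ≥ 0 and χ ≤ 1, φ(x+y) ≥ χ(y) φ(x+y); Taylor's formula is applied only to the latter.
  have low : φ x * ∫ y, χ y ∂(μ δ) + ℓ (∫ y, χ y • y ∂(μ δ)) - M * ∫ y, χ y * ‖y‖ ^ 2 ∂(μ δ) ≤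
      ∫ y, φ (x + y) ∂(μ δ) := by
    rw [← ℓ.integral_comp_comm (ContDiffBump.integrable_smul_self _), ← integral_const_mul,
      ← integral_const_mul, ← integral_add i1 i2]
    refine (integral_sub (i1.add i2) i3).symm.trans_le ?_
    refine integral_mono ((i1.add i2).sub i3) i4 fun y => ?_
    have t1 : -(M * ‖y‖ ^ 2) ≤ φ (x + y) - φ x - ℓ y := (abs_le.1 (hT x y)).1
    have t2 := χ.nonneg (x := y)
    have t3 := χ.le_one (x := y)
    have t4 := mul_le_mul_of_nonneg_left t1 t2
    have t5 := mul_le_of_le_one_left (h0 (x + y)) t3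
    simp only [Pi.add_apply, map_smul, smul_eq_mul]
    nlinarith
  have up := (abs_le.1 (hT x (δ • b))).2
  rw [map_smul, smul_eq_mul, norm_smul, Real.norm_of_nonneg hδ0.le, mul_pow] at up
  have hφS : φ x ≤ S := (le_abs_self _).trans (hS x)
  have k1 : φ x * (1 - δ * (C + θ)) ≤ φ x * ∫ y, χ y ∂(μ δ) :=
    mul_le_mul_of_nonneg_left g1 (h0 x)
  have k2 : δ * ℓ b - L * (δ * (η * C + θ)) ≤ ℓ (∫ y, χ y • y ∂(μ δ)) := by
    have := (ℓ.le_opNorm ((∫ y, χ y • y ∂(μ δ)) - δ • b)).trans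
      (mul_le_mul (hLip x) g3 (norm_nonneg _) hL)
    rw [Real.norm_eq_abs, map_sub, map_smul, smul_eq_mul] at this
    have := (abs_le.1 this).1
    linarith
  have k3 : M * ∫ y, χ y * ‖y‖ ^ 2 ∂(μ δ) ≤ M * (δ * (η ^ 2 * C + θ)) :=
    mul_le_mul_of_nonneg_left g2 hM
  have k4 : |ℓ b| ≤ L * ‖b‖ := by
    have := (ℓ.le_opNorm b).trans (mul_le_mul_of_nonneg_right (hLip x) (norm_nonneg b))
    rwa [Real.norm_eq_abs] at this
  have k5 : (1 - δ * C) * φ (x + δ • b) ≤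
      (1 - δ * C) * (φ x + δ * ℓ b) + M * (δ ^ 2 * ‖b‖ ^ 2) := by
    have h1 : 0 ≤ δ * C := by positivity
    have h2 : 0 ≤ M * (δ ^ 2 * ‖b‖ ^ 2) := by positivity
    nlinarith [mul_le_mul_of_nonneg_left up (sub_nonneg.2 g5.le)]
  have k6 : -(δ * C * (δ * ℓ b)) ≤ δ * (δ * (C * L * ‖b‖)) := by
    have h1 := mul_le_mul_of_nonneg_left (neg_le_of_abs_le k4)
      (show 0 ≤ δ * C * δ by positivity)
    linarith
  have k7 : δ * (δ * (C * L * ‖b‖ + M * ‖b‖ ^ 2)) ≤ δ * (κ / 4) :=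
    mul_le_mul_of_nonneg_left g4.le hδ0.le
  have k8 : δ * (η * (L * C + M * C)) ≤ δ * (κ / 4) := mul_le_mul_of_nonneg_left hηκ hδ0.le
  have k9 : δ * (θ * (S + L + M)) ≤ δ * (κ / 4) := mul_le_mul_of_nonneg_left hθκ hδ0.le
  have k10 : M * (δ * (η ^ 2 * C)) ≤ δ * (η * (M * C)) := by
    have : η ^ 2 ≤ η := by nlinarith
    have := mul_le_mul_of_nonneg_right this (show 0 ≤ M * (δ * C) by positivity)
    linarith
  have k11 : φ x * (δ * θ) ≤ S * (δ * θ) := mul_le_mul_of_nonneg_right hφS (by positivity)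
  nlinarith

/-- Euler scheme: n steps of length t/n multiply the factors 1 - Ct/n and add the drifts, while the
errors κt/n sum to κt, with κ = ε/t. -/
lemma IsPureJumpLevySemigroup.le_integral (hμ : IsPureJumpLevySemigroup ν μ)
    [IsFiniteMeasure ν] {φ : E → ℝ} (hφ : ContDiff ℝ ∞ φ) (hs : HasCompactSupport φ)
    (h0 : ∀ x, 0 ≤ φ x) {t : ℝ} (ht : 0 < t) :
    Real.exp (-(t * ν.real univ)) * φ (t • levyDrift ν) ≤ ∫ y, φ y ∂(μ t) := by
  set C := ν.real univ
  have hC0 : 0 ≤ C := measureReal_nonneg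
  set b := levyDrift ν
  obtain ⟨S, hS⟩ := hφ.continuous.bounded_above_of_compact_support hs
  have iter : ∀ κ δ : ℝ, 0 < κ → 0 < δ → δ * C ≤ 1 →
      (∀ x, (1 - δ * C) * φ (x + δ • b) - κ * δ ≤ ∫ y, φ (x + y) ∂(μ δ)) → ∀ (k : ℕ) (x : E),
      (1 - δ * C) ^ k * φ (x + (k * δ) • b) - k * (κ * δ) ≤ ∫ y, φ (x + y) ∂(μ (k * δ)) := by
    intro κ δ hκ hδ hδC hstep k
    induction k with
    | zero =>
      intro x
      simp [hμ.zero]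
    | succ k ih =>
      intro x
      have hkδ : (0 : ℝ) ≤ k * δ := by positivity
      have := hμ.isProbabilityMeasure _ hkδ
      have := hμ.isProbabilityMeasure δ hδ.le
      have int : ∀ (ρ : Measure E) [IsProbabilityMeasure ρ] (x : E),
          Integrable (fun y => φ (x + y)) ρ := fun ρ _ x =>
        Integrable.of_bound (hφ.continuous.comp (by fun_prop)).aestronglyMeasurable S
          (Eventually.of_forall fun y => hS _)
      have e1 : ((k + 1 : ℕ) : ℝ) * δ = k * δ + δ := by push_cast; ring
      have e2 : ∫ y, φ (x + y) ∂(μ ((k + 1 : ℕ) * δ)) =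
          ∫ y, ∫ z, φ (x + y + z) ∂(μ δ) ∂(μ (k * δ)) := by
        rw [e1, hμ.add _ _ hkδ hδ.le,
          Measure.integral_conv_eq (f := fun y => φ (x + y))
            (hφ.continuous.comp (by fun_prop)).measurable (int _ x)]
        simp only [add_assoc]
      have i1 : Integrable (fun y => (1 - δ * C) * φ (x + δ • b + y) - κ * δ) (μ (k * δ)) :=
        ((int _ _).const_mul _).sub (integrable_const _)
      have i2 : Integrable (fun y => ∫ z, φ (x + y + z) ∂(μ δ)) (μ (k * δ)) := by
        refine Integrable.of_bound (Measurable.aestronglyMeasurable ?_) S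
          (Eventually.of_forall fun y => ?_)
        · have hm : Measurable fun p : E × E => φ (x + p.1 + p.2) :=
            (hφ.continuous.comp (by fun_prop)).measurable
          exact (hm.stronglyMeasurable.integral_prod_right' (ν := μ δ)).measurable
        · exact (norm_integral_le_of_norm_le_const (Eventually.of_forall fun z => hS _)).trans
            (by simp)
      have h1 : ∫ y, ((1 - δ * C) * φ (x + δ • b + y) - κ * δ) ∂(μ (k * δ)) ≤
          ∫ y, ∫ z, φ (x + y + z) ∂(μ δ) ∂(μ (k * δ)) := by
        refine integral_mono i1 i2 fun y => ?_
        have := hstep (x + y)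
        rwa [add_right_comm] at this
      rw [integral_sub ((int _ _).const_mul _) (integrable_const _), integral_const_mul,
        integral_const, probReal_univ, one_smul] at h1
      rw [e2]
      refine le_trans ?_ h1
      have h2 := mul_le_mul_of_nonneg_left (ih (x + δ • b)) (sub_nonneg.2 hδC)
      have e3 : x + δ • b + ((k : ℝ) * δ) • b = x + (((k + 1 : ℕ) : ℝ) * δ) • b := by
        rw [e1, add_smul]; abel
      rw [e3] at h2
      have h3 : (1 - δ * C) * (k * (κ * δ)) ≤ k * (κ * δ) :=
        mul_le_of_le_one_left (by positivity) (by nlinarith)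
      rw [pow_succ']
      push_cast at h2 ⊢
      nlinarith
  refine le_of_forall_pos_le_add fun ε hε => ?_
  have hlim : Tendsto (fun n : ℕ => (1 + -(t * C) / (n : ℝ)) ^ n * φ (t • b) - ε) atTop
      (𝓝 (Real.exp (-(t * C)) * φ (t • b) - ε)) :=
    ((Real.tendsto_one_add_div_pow_exp _).mul_const _).sub_const _
  have hdiv : Tendsto (fun n : ℕ => t / (n : ℝ)) atTop (𝓝[>] 0) := by
    refine tendsto_nhdsWithin_iff.2 ⟨tendsto_const_div_atTop_nhds_zero_nat t, ?_⟩
    filter_upwards [eventually_gt_atTop 0] with n hn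
    exact div_pos ht (by positivity)
  have hev := hdiv.eventually (hμ.eventually_le_integral hφ hs h0 (div_pos hε ht))
  have hC1 : ∀ᶠ n : ℕ in atTop, t / n * C < 1 := by
    have : Tendsto (fun n : ℕ => t / (n : ℝ) * C) atTop (𝓝 0) := by
      simpa using (tendsto_const_div_atTop_nhds_zero_nat t).mul_const C
    exact this.eventually (gt_mem_nhds one_pos)
  have : Real.exp (-(t * C)) * φ (t • b) - ε ≤ ∫ y, φ y ∂(μ t) := by
    refine le_of_tendsto hlim ?_
    filter_upwards [hev, hC1, eventually_gt_atTop 0] with n h1 h2 hn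
    have hn' : (0 : ℝ) < n := by positivity
    have h3 := iter (ε / t) (t / n) (div_pos hε ht) (by positivity) h2.le h1 n 0
    have e1 : (n : ℝ) * (t / n) = t := by field_simp
    have e2 : (n : ℝ) * (ε / t * (t / n)) = ε := by field_simp
    have e3 : 1 + -(t * C) / n = 1 - t / n * C := by ring
    rw [e1, e2] at h3
    simpa only [e3, zero_add] using h3
  linarith

/-- A Lévy process with finite jump measure has not jumped before time `t` with probability at
least `exp (-t ν(E))`. -/
lemma IsPureJumpLevySemigroup.exp_le_measure_singleton (hμ : IsPureJumpLevySemigroup ν μ)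
    [IsFiniteMeasure ν] {t : ℝ} (ht : 0 < t) :
    Real.exp (-(t * ν.real univ)) ≤ (μ t).real {t • levyDrift ν} := by
  have := hμ.isProbabilityMeasure t ht.le
  set c := t • levyDrift ν
  have hr : ∀ n : ℕ, (0 : ℝ) < 1 / ((n : ℝ) + 1) := fun n => by positivity
  -- Bumps equal to 1 at c with supports shrinking to {c}: their integrals converge to the mass of
  -- the atom.
  let φ : ℕ → ContDiffBump c := fun n =>
    ⟨1 / ((n : ℝ) + 1) / 2, 1 / ((n : ℝ) + 1), half_pos (hr n), half_lt_self (hr n)⟩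
  have h1 : ∀ n, Real.exp (-(t * ν.real univ)) ≤ ∫ y, φ n y ∂(μ t) := fun n => by
    have := hμ.le_integral (φ n).contDiff (φ n).hasCompactSupport (fun x => (φ n).nonneg) ht
    rwa [(φ n).one_of_mem_closedBall (Metric.mem_closedBall_self (φ n).rIn_pos.le), mul_one]
      at this
  have hlim : Tendsto (fun n => ∫ y, φ n y ∂(μ t)) atTop
      (𝓝 (∫ y, ({c} : Set E).indicator (fun _ => (1 : ℝ)) y ∂(μ t))) := by
    refine tendsto_integral_of_dominated_convergence (fun _ => 1)
      (fun n => (φ n).continuous.aestronglyMeasurable) (integrable_const _)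
      (fun n => Eventually.of_forall fun y => ?_) (Eventually.of_forall fun y => ?_)
    · rw [Real.norm_of_nonneg (φ n).nonneg]; exact (φ n).le_one
    · by_cases hy : y = c
      · have : ∀ n, φ n y = 1 := fun n => by
          rw [hy]
          exact (φ n).one_of_mem_closedBall (Metric.mem_closedBall_self (φ n).rIn_pos.le)
        simp only [this]
        rw [indicator_of_mem (by simpa using hy)]
        exact tendsto_const_nhds
      · rw [indicator_of_notMem (by simpa using hy)]
        refine tendsto_const_nhds.congr' ?_
        have hd : 0 < dist y c := dist_pos.2 hy
        filter_upwards [(tendsto_one_div_add_atTop_nhds_zero_nat (𝕜 := ℝ)).eventually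
          (gt_mem_nhds hd)] with n hn
        exact ((φ n).zero_of_le_dist hn.le).symm
  rw [integral_indicator_const _ (measurableSet_singleton c), smul_eq_mul, mul_one] at hlim
  exact ge_of_tendsto' hlim h1

end Atom

/-! ### Removal of a deterministic drift -/

section Shift

variable {E : Type*} [NormedAddCommGroup E] [NormedSpace ℝ E] [MeasurableSpace E] [BorelSpace E]
  {μ : ℝ → Measure E}

/-- The family of laws of `X_t - t b`. -/
noncomputable def shiftFamily (μ : ℝ → Measure E) (b : E) (t : ℝ) : Measure E :=
  (μ t).map fun y => y - t • b

omit [NormedSpace ℝ E] in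
lemma measurable_sub_const_vec (c : E) : Measurable fun y : E => y - c :=
  (continuous_id.sub continuous_const).measurable

omit [NormedSpace ℝ E] in
lemma IsConvolutionSemigroup.tendsto_measureReal_norm_ge (hμ : IsConvolutionSemigroup μ) {η : ℝ}
    (hη : 0 < η) : Tendsto (fun t => (μ t).real {y | η ≤ ‖y‖}) (𝓝[>] 0) (𝓝 0) := by
  have hc : Continuous fun y : E => min 1 (‖y‖ / η) := by fun_prop
  have hb : ∀ y : E, |min 1 (‖y‖ / η)| ≤ 1 := fun y => by
    rw [abs_of_nonneg (by positivity)]; exact min_le_left _ _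
  have h := hμ.tendsto_zero _ hc ⟨1, hb⟩
  simp only [norm_zero, zero_div, zero_le_one, inf_of_le_right] at h
  refine squeeze_zero' (Eventually.of_forall fun t => measureReal_nonneg) ?_ h
  filter_upwards [self_mem_nhdsWithin] with t ht
  have := hμ.isProbabilityMeasure t (le_of_lt ht)
  have hS : MeasurableSet {y : E | η ≤ ‖y‖} := (isClosed_le continuous_const
    continuous_norm).measurableSet
  have hint : Integrable (fun y : E => min 1 (‖y‖ / η)) (μ t) :=
    Integrable.of_bound hc.aestronglyMeasurable 1 (Eventually.of_forall hb)
  calc (μ t).real {y | η ≤ ‖y‖} = ∫ y, {y : E | η ≤ ‖y‖}.indicator (fun _ => (1 : ℝ)) y ∂(μ t) := by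
        rw [integral_indicator_const _ hS, smul_eq_mul, mul_one]
    _ ≤ _ := by
        refine integral_mono ((integrable_const _).indicator hS) hint fun y => ?_
        by_cases hy : y ∈ {y : E | η ≤ ‖y‖}
        · rw [indicator_of_mem hy]
          exact le_min le_rfl ((one_le_div hη).2 hy)
        · rw [indicator_of_notMem hy]
          positivity

lemma IsConvolutionSemigroup.convolutionFamily_shift [SecondCountableTopology E]
    (hμ : IsConvolutionSemigroup μ) (b : E) : ConvolutionFamily (shiftFamily μ b) where
  prob t ht := by
    have := hμ.isProbabilityMeasure t ht
    exact Measure.isProbabilityMeasure_map (measurable_sub_const_vec _).aemeasurable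
  zero := by
    rw [shiftFamily, hμ.zero, Measure.map_dirac' (measurable_sub_const_vec _)]
    simp
  add s t hs ht := by
    have := hμ.isProbabilityMeasure s hs
    have := hμ.isProbabilityMeasure t ht
    refine Measure.ext_of_lintegral _ fun F hF => ?_
    have ms := measurable_sub_const_vec (s • b)
    have mt := measurable_sub_const_vec (t • b)
    have : IsProbabilityMeasure ((μ t).map fun y => y - t • b) :=
      Measure.isProbabilityMeasure_map mt.aemeasurable
    simp only [shiftFamily]
    rw [lintegral_map hF (measurable_sub_const_vec _), hμ.add s t hs ht,
      Measure.lintegral_conv (f := fun y => F (y - (s + t) • b))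
        (hF.comp (measurable_sub_const_vec _)), Measure.lintegral_conv hF,
      lintegral_map (Measurable.lintegral_prod_right' (f := fun p : E × E => F (p.1 + p.2))
        (by fun_prop)) ms]
    refine lintegral_congr fun x => ?_
    rw [lintegral_map (by fun_prop) mt]
    refine lintegral_congr fun y => ?_
    congr 1
    rw [add_smul, sub_add_sub_comm]
  small η hη := by
    have h := hμ.tendsto_measureReal_norm_ge (half_pos hη)
    refine squeeze_zero' (Eventually.of_forall fun t => measureReal_nonneg) ?_ h
    have hs := (tendsto_mul_const_nhdsGT_zero ‖b‖).eventually (gt_mem_nhds (half_pos hη))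
    filter_upwards [self_mem_nhdsWithin, hs] with t ht hsm
    have ht0 : (0 : ℝ) < t := ht
    have := hμ.isProbabilityMeasure t ht0.le
    rw [shiftFamily, map_measureReal_apply (measurable_sub_const_vec _)
      (isClosed_le continuous_const continuous_norm).measurableSet]
    refine measureReal_mono fun y hy => ?_
    have h1 : η ≤ ‖y - t • b‖ := hy
    have h2 := norm_sub_le y (t • b)
    rw [norm_smul, Real.norm_of_nonneg ht0.le] at h2
    change η / 2 ≤ ‖y‖
    linarith

lemma levyAct_eq_shift (b : E) (t : ℝ) {f : E → ℝ≥0∞} (hf : Measurable f) (x : E)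
    [SecondCountableTopology E] :
    levyAct μ t f x = ∫⁻ y, f (x + t • b + y) ∂(shiftFamily μ b t) := by
  rw [levyAct, shiftFamily, lintegral_map (by fun_prop) (measurable_sub_const_vec _)]
  refine lintegral_congr fun y => ?_
  congr 1; abel

/-- A drift only translates the base point, and the translations by s b and (t-s) b add up to t b.
The inequality for the centred laws is therefore the one for the original semigroup, with base point
x + t b. -/
lemma IsConvolutionSemigroup.levyAct_rpow_le [ProperSpace E] (hμ : IsConvolutionSemigroup μ)
    (b : E) {t s q₁ q₂ K : ℝ} (hs : 0 < s) (hst : s ≤ t) (hq₁ : 0 < q₁) (hq₁1 : q₁ < 1)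
    (hq₂ : 0 < q₂) (hq₂1 : q₂ < 1) (hK : 0 ≤ K)
    (hk : HasCellBound (shiftFamily μ b) t (s / t) q₁ (q₂ / (1 - q₂)) K)
    {f : E → ℝ≥0∞} (hf : Measurable f) (x : E) :
    levyAct μ t (fun y => f y ^ q₁) x ^ (1 / q₁) ≤
      levyAct μ s (fun y => levyAct μ (t - s) f y ^ q₂) x ^ (1 / q₂) * ENNReal.ofReal K := by
  have hfam := hμ.convolutionFamily_shift b
  have hw : 0 ≤ t - s := sub_nonneg.2 hst
  have := hfam.prob _ hw
  have hm : Measurable fun y => levyAct μ (t - s) f y := by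
    simp only [levyAct_eq_shift b (t - s) hf]
    exact Measurable.lintegral_prod_right'
      (f := fun p : E × E => f (p.1 + (t - s) • b + p.2)) (by fun_prop)
  have main := hfam.lintegral_rpow_le hs hst hq₁ hq₁1 hq₂ hq₂1 hK hk
    (f := fun y => f (x + t • b + y)) (by fun_prop)
  rw [levyAct_eq_shift b t (hf.pow_const q₁), levyAct_eq_shift b s (hm.pow_const q₂), mul_comm]
  refine main.trans_eq ?_
  congr 3
  funext y
  rw [levyAct_eq_shift b (t - s) hf]
  congr 2
  ext z
  congr 1
  rw [sub_smul]; abel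

lemma IsConvolutionSemigroup.hasCellBound_one [SecondCountableTopology E]
    (hμ : IsConvolutionSemigroup μ) (b : E) {t r a β : ℝ} (ht : 0 ≤ t)
    (hr : 0 < r) (hr1 : r ≤ 1) (ha : 0 < a) (ha1 : a < 1) (hβ : β = r * (a / (1 - a))) :
    HasCellBound (shiftFamily μ b) t r a β 1 := by
  refine ⟨fun _ => 1, fun _ => zero_le_one, by simp, Eventually.of_forall fun n => ?_⟩
  have := (hμ.convolutionFamily_shift b).prob (t / n) (by positivity)
  exact ReverseHC.thinnedPair_one _ hr hr1 ha ha1 hβ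

end Shift

/-! ### Cell constants for finite ν and conclusion -/

section Final

variable {E : Type*} [NormedAddCommGroup E] [InnerProductSpace ℝ E] [FiniteDimensional ℝ E]
  [MeasurableSpace E] [BorelSpace E] {ν : Measure E} {μ : ℝ → Measure E}

lemma IsPureJumpLevySemigroup.hasCellBound_exp (hμ : IsPureJumpLevySemigroup ν μ)
    [IsFiniteMeasure ν] {t r a β : ℝ} (ht : 0 < t) (ha : 0 < a) (ha1 : a < 1) (hβ : 0 < β)
    (hβa : β < a / (1 - a)) (hr : r = (1 + β) / (1 + a / (1 - a))) :
    HasCellBound (shiftFamily μ (levyDrift ν)) t r a β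
      (Real.exp (t * ν.real univ * (r / β - 1 / (a / (1 - a))))) := by
  obtain ⟨M, p₀, hp₀, H⟩ := ReverseHC.exists_thinnedPair_atom E ha ha1 hβ hβa hr
  set A := r / β - 1 / (a / (1 - a))
  set C := ν.real univ
  have hC : 0 ≤ C := measureReal_nonneg
  have hp : Tendsto (fun n : ℕ => t * C / n) atTop (𝓝 0) :=
    tendsto_const_div_atTop_nhds_zero_nat _
  -- The missing mass is p = tC/n. In the n-th power the linear term becomes tCA and the quadratic
  -- one is of order 1/n.
  refine ⟨fun n => Real.exp (t * C / n * A + M * (t * C / n) ^ 2), fun n => (Real.exp_pos _).le,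
    ?_, ?_⟩
  · have hlim : Tendsto (fun n : ℕ => Real.exp (t * C * A + M * (t * C) * (t * C / n))) atTop
        (𝓝 (Real.exp (t * C * A))) := by
      have := (hp.const_mul (M * (t * C))).const_add (t * C * A)
      rw [mul_zero, add_zero] at this
      exact (Real.continuous_exp.tendsto _).comp this
    refine hlim.congr' ?_
    filter_upwards [eventually_gt_atTop 0] with n hn
    have hn' : (n : ℝ) ≠ 0 := by positivity
    rw [← Real.exp_nat_mul]
    congr 1
    field_simp
  · filter_upwards [hp.eventually (ge_mem_nhds hp₀), eventually_gt_atTop 0] with n h1 hn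
    have htn : 0 < t / n := by positivity
    have hprob := (hμ.toIsConvolutionSemigroup.convolutionFamily_shift (levyDrift ν)).prob _ htn.le
    refine H _ hprob _ (by positivity) h1 ?_
    rw [shiftFamily, map_measureReal_apply (measurable_sub_const_vec _)
      (measurableSet_singleton _)]
    have hpre : (fun y => y - (t / n) • levyDrift ν) ⁻¹' {0} = {(t / n) • levyDrift ν} := by
      ext y; simp [sub_eq_zero]
    rw [hpre]
    refine le_trans ?_ (hμ.exp_le_measure_singleton htn)
    have := Real.one_sub_le_exp_neg (t / n * C)
    have e : t * C / n = t / n * C := by ring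
    rwa [e]

end Final

theorem mainTheorem7 {E : Type*} [NormedAddCommGroup E] [InnerProductSpace ℝ E]
    [FiniteDimensional ℝ E] [MeasurableSpace E] [BorelSpace E]
    (ν : Measure E) (hν : IsLevyMeasure ν)
    (μ : ℝ → Measure E) (hμ : IsPureJumpLevySemigroup ν μ) :
    (∀ s t q₁ q₂ : ℝ, 0 < s → s ≤ t → 0 < q₂ → q₂ ≤ q₁ → q₁ < 1 →
      q₂ - 1 = q₂ / q₁ * (t / s) * (q₁ - 1) →
      ∀ f : E → ℝ≥0∞, Measurable f → ∀ x : E,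
        levyAct μ t (fun y => f y ^ q₁) x ^ (1 / q₁) ≤
          levyAct μ s (fun y => levyAct μ (t - s) f y ^ q₂) x ^ (1 / q₂)) ∧
    (ν univ < ⊤ →
      ∀ s t q₁ q₂ : ℝ, 0 < s → s ≤ t → 0 < q₂ → q₂ ≤ q₁ → q₁ < 1 →
      q₂ - 1 = t / s * (q₁ - 1) →
      ∀ f : E → ℝ≥0∞, Measurable f → ∀ x : E,
        levyAct μ t (fun y => f y ^ q₁) x ^ (1 / q₁) ≤
          levyAct μ s (fun y => levyAct μ (t - s) f y ^ q₂) x ^ (1 / q₂) *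
            ENNReal.ofReal (Real.exp
              (ν.real univ * (s * (t - s) * (1 - q₂) ^ 2 / (q₂ * (s * q₂ + t - s)))))) := by
  constructor
  · intro s t q₁ q₂ hs hst hq₂ hq hq₁ hrel f hf x
    have ht : 0 < t := hs.trans_le hst
    have h1 : 0 < 1 - q₁ := by linarith
    have h2 : 0 < 1 - q₂ := by linarith
    have hq₁0 : 0 < q₁ := hq₂.trans_le hq
    have hβ : q₂ / (1 - q₂) = s / t * (q₁ / (1 - q₁)) := by
      have e : 1 - q₂ = q₂ / q₁ * (t / s) * (1 - q₁) := by linarith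
      rw [e]; field_simp
    -- No atom is needed in this part, so the drift is left in place (shift by 0).
    have hk := hμ.toIsConvolutionSemigroup.hasCellBound_one 0 ht.le (div_pos hs ht)
      ((div_le_one ht).2 hst) hq₁0 hq₁ hβ
    simpa using hμ.toIsConvolutionSemigroup.levyAct_rpow_le 0 hs hst hq₁0 hq₁ hq₂
      (hq.trans_lt hq₁) zero_le_one hk hf x
  · intro hfin s t q₁ q₂ hs hst hq₂ hq hq₁ hrel f hf x
    have : IsFiniteMeasure ν := ⟨hfin⟩
    have ht : 0 < t := hs.trans_le hst
    have h1 : 0 < 1 - q₁ := by linarith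
    have h2 : 0 < 1 - q₂ := by linarith
    have hq₁0 : 0 < q₁ := hq₂.trans_le hq
    have e : 1 - q₂ = t / s * (1 - q₁) := by linarith
    have e' : s * (1 - q₂) = t * (1 - q₁) := by rw [e]; field_simp
    refine hμ.toIsConvolutionSemigroup.levyAct_rpow_le (levyDrift ν) hs hst hq₁0 hq₁ hq₂
      (hq.trans_lt hq₁) (Real.exp_pos _).le ?_ hf x
    -- At s = t the exponents coincide and the strict inequality b < α required by the atom estimate
    -- fails; there the constant is 1 and the AM-GM bound with r = 1 applies.
    rcases hst.eq_or_lt with rfl | hlt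
    · have hqq : q₂ = q₁ := by
        rw [div_self hs.ne', one_mul] at e
        linarith
      subst hqq
      rw [sub_self, mul_zero, zero_mul, zero_div, mul_zero, Real.exp_zero]
      refine hμ.toIsConvolutionSemigroup.hasCellBound_one _ hs.le (div_pos hs hs)
        (div_self hs.ne').le hq₂ hq₁ ?_
      rw [div_self hs.ne', one_mul]
    · have hlt' : q₂ < q₁ := by nlinarith
      have hr : s / t = (1 + q₂ / (1 - q₂)) / (1 + q₁ / (1 - q₁)) := by
        have e1 : 1 + q₂ / (1 - q₂) = 1 / (1 - q₂) := by field_simp; ring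
        have e2 : 1 + q₁ / (1 - q₁) = 1 / (1 - q₁) := by field_simp; ring
        rw [e1, e2, div_div_div_eq, div_eq_div_iff ht.ne' (by positivity)]
        linarith
      have hk := hμ.hasCellBound_exp ht hq₁0 hq₁ (div_pos hq₂ h2)
        (by rw [div_lt_div_iff₀ h2 h1]; nlinarith) hr
      convert hk using 2
      have hd : 0 < s * q₂ + t - s := by have := mul_pos hs hq₂; linarith
      have hq₁t : q₁ = (s * q₂ + t - s) / t := by
        rw [eq_div_iff ht.ne']; linarith
      have e3 : 1 - q₁ = s * (1 - q₂) / t := by rw [eq_div_iff ht.ne']; linarith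
      -- The limiting exponent t(r/b - 1/α) is rewritten in terms of q₂, using t q₁ = s q₂ + t - s.
      have key : t * (s / t / (q₂ / (1 - q₂)) - 1 / (q₁ / (1 - q₁))) =
          s * (t - s) * (1 - q₂) ^ 2 / (q₂ * (s * q₂ + t - s)) := by
        rw [e3, hq₁t]
        field_simp
        ring
      rw [← key]
      ring
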